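/- Let $p$ be an odd prime, $s_1,s_2\ge 1$, $s=s_1+s_2$, and let $\mathbb F=\mathbb F_{p^{s_1}}\times\mathbb F_{p^{s_2}}$, with the $\mathbb F_p$-bilinear form $\mathrm{Tr}\big((x,y)\odot(u,v)\big)=\mathrm{Tr}_{\mathbb F_{p^{s_1}}/\mathbb F_p}(xu)+\mathrm{Tr}_{\mathbb F_{p^{s_2}}/\mathbb F_p}(yv)$. Let $f:\mathbb F_{p^{s_1}}\to\mathbb F_p$ be a quadratic form over $\mathbb F_p$ and $F(x,y)=\tfrac12\big(f(x+y)-f(x)-f(y)\big)$. Its rank $R_f$ is the rank of the matrix of $F$ in an $\mathbb F_p$-basis of $\mathbb F_{p^{s_1}}$, and its sign $\varepsilon_f\in\{1,-1\}$ is the quadratic character of $\mathbb F_p$ evaluated at the product of the nonzero coefficients in a diagonalization of $f$. Assume $R_f\ge 3$, let $\alpha\in\mathbb F_{p^{s_2}}^*$, and put $$D=\{(x,y)\in\mathbb F\setminus\{(0,0)\}: f(x)+\mathrm{Tr}_{\mathbb F_{p^{s_2}}/\mathbb F_p}(\alpha y)=0\},\qquad C_D=\big\{\big(\mathrm{Tr}(X\odot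 Y)\big)_{Y\in D}: X\in\mathbb F\big\}\subseteq\mathbb F_p^{D}.$$ For an $\mathbb F_p$-linear code $C$ and $1\le r\le\dim C$, let $d_r(C)$ be the minimum, over the $r$-dimensional subspaces $H$ of $C$, of the number of coordinates at which some word of $H$ is nonzero. Define $$e_0=\begin{cases}s_1-\frac{R_f+1}{2},& R_f\text{ odd},\\ s_1-\frac{R_f}{2},& R_f\text{ even and }\varepsilon_f=(-1)^{R_f(p-1)/4},\\ s_1-\frac{R_f+2}{2},& R_f\text{ even and }\varepsilon_f=-(-1)^{R_f(p-1)/4}.\end{cases}$$ Then $\dim_{\mathbb F_p}C_D=s$, and the weight hierarchy of $C_D$ is as follows. (1) If $s_1-e_0+1\le r\le s$, then $d_r(C_D)=p^{s-1}-p^{s-r}$. (2) If $0<r\le s_1-e_0$, then $$d_r(C_D)=\begin{cases}p^{s-1}-p^{s-1-r}-p^{s-1-\frac{R_f+1}{2}},& R_f\text{ odd},\\ p^{s-1}-p^{s-1-r}-(p-1)p^{s-1-\frac{R_f+2}{2}},& R_f\text{ even and }\varepsilon_f=(-1)^{R_f(p-1)/4},\\ p^{s-1}-p^{s-1-r}-p^{s-1-\frac{R_f+2}{2}},&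 R_f\text{ even and }\varepsilon_f=-(-1)^{R_f(p-1)/4}.\end{cases}$$ -/

import Mathlib

noncomputable section

namespace WeightHierarchy

section QuadraticForms

variable {K : Type*} [Field K] {V : Type*} [AddCommGroup V] [Module K V]

/-- The symmetric bilinear form `F(x, y) = (f(x + y) - f(x) - f(y)) / 2` of a quadratic form `f`. -/
def bilin (f : QuadraticForm K V) : V →ₗ[K] V →ₗ[K] K :=
  (2 : K)⁻¹ • QuadraticMap.polarBilin f

/-- The rank of `f`: the rank of the linear map `x ↦ F(x, ·)`, which is the rank of the
matrix `(F(v_i, v_j))` in any basis `v`, and the codimension of `{x | ∀ y, F(x, y) = 0}`. -/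
def rank (f : QuadraticForm K V) : ℕ :=
  Module.finrank K (LinearMap.range (bilin f))

/-- `f` becomes the diagonal form `∑ i, w i * x_i ^ 2` in the coordinates with respect to some
basis of `V`. -/
def IsDiagonalization (f : QuadraticForm K V) (w : Fin (Module.finrank K V) → K) : Prop :=
  QuadraticMap.Equivalent f (QuadraticMap.weightedSumSquares K w)

open Classical in
/-- The product of the nonzero diagonal coefficients (the empty product is `1`). -/
def nonzeroProd {n : ℕ} (w : Fin n → K) : K :=
  ∏ i with w i ≠ 0, w i

/-- Over a field of characteristic different from two, every form has a diagonalization. -/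
theorem exists_isDiagonalization (h2 : (2 : K) ≠ 0) [FiniteDimensional K V]
    (f : QuadraticForm K V) : ∃ w, IsDiagonalization f w := by
  have : Invertible (2 : K) := invertibleOfNonzero h2
  exact f.equivalent_weightedSumSquares

open Classical in
/-- The sign of `f`: the quadratic character of the product of the nonzero coefficients in a
diagonalization of `f`. By `sign_eq`, it does not depend on the diagonalization. (The value `0`
is never taken when `2 ≠ 0` and `V` is finite-dimensional.) -/
def sign [Fintype K] (f : QuadraticForm K V) : ℤ :=
  if h : ∃ w, IsDiagonalization f w then quadraticChar K (nonzeroProd h.choose) else 0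

theorem toMatrix_weightedSumSquares [Invertible (2 : K)] {n : ℕ} (w : Fin n → K) :
    QuadraticForm.toMatrix' (QuadraticMap.weightedSumSquares K w) = Matrix.diagonal w := by
  ext i j
  rw [QuadraticForm.toMatrix', LinearMap.toMatrix₂'_apply, QuadraticMap.associated_apply]
  simp only [QuadraticMap.weightedSumSquares_apply, smul_eq_mul, Pi.add_apply]
  rw [← Finset.sum_sub_distrib, ← Finset.sum_sub_distrib]
  have h : ∀ k, w k * ((Pi.single (M := fun _ => K) i 1 k + Pi.single (M := fun _ => K) j 1 k) *
      (Pi.single (M := fun _ => K) i 1 k + Pi.single (M := fun _ => K) j 1 k)) -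
      w k * (Pi.single (M := fun _ => K) i 1 k * Pi.single (M := fun _ => K) i 1 k) -
      w k * (Pi.single (M := fun _ => K) j 1 k * Pi.single (M := fun _ => K) j 1 k) =
      if k = i then (if i = j then 2 * w i else 0) else 0 := by
    intro k
    by_cases hi : k = i
    · subst hi
      by_cases hj : k = j
      · subst hj; simp; ring
      · simp [hj]
    · by_cases hj : k = j
      · subst hj; simp [hi]
      · simp [hi, hj]
  rw [Finset.sum_congr rfl (fun k _ => h k)]
  by_cases hij : i = j
  · subst hij; simp; field_simp
  · simp [hij]

open Classical in
/-- The products of the nonzero coefficients of two diagonalizations differ by a square. -/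
theorem nonzeroProd_eq_sq_mul (h2 : (2 : K) ≠ 0) {n : ℕ} {w w' : Fin n → K}
    (h : QuadraticMap.Equivalent (QuadraticMap.weightedSumSquares K w)
      (QuadraticMap.weightedSumSquares K w')) :
    ∃ c : K, c ≠ 0 ∧ nonzeroProd w = c ^ 2 * nonzeroProd w' := by
  have : Invertible (2 : K) := invertibleOfNonzero h2
  obtain ⟨e⟩ := h
  set M := LinearMap.toMatrix' (e.toLinearEquiv : (Fin n → K) →ₗ[K] (Fin n → K)) with hM
  have hcomp : (QuadraticMap.weightedSumSquares K w').comp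
      (e.toLinearEquiv : (Fin n → K) →ₗ[K] (Fin n → K)) = QuadraticMap.weightedSumSquares K w := by
    ext x
    exact e.map_app x
  have hmat : Matrix.diagonal w = M.transpose * Matrix.diagonal w' * M := by
    rw [← toMatrix_weightedSumSquares, ← toMatrix_weightedSumSquares, ← hcomp,
      QuadraticForm.toMatrix'_comp]
  have hdet : IsUnit M.det := by
    rw [hM, LinearMap.det_toMatrix']
    exact LinearEquiv.isUnit_det' _
  have hcard : Fintype.card {i // w i ≠ 0} = Fintype.card {i // w' i ≠ 0} := by
    rw [← Matrix.rank_diagonal, ← Matrix.rank_diagonal, hmat,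
      Matrix.rank_mul_eq_left_of_isUnit_det _ _ hdet,
      Matrix.rank_mul_eq_right_of_isUnit_det _ _ (by rwa [Matrix.det_transpose])]
  let σ : {i // w i ≠ 0} ≃ {i // w' i ≠ 0} := Fintype.equivOfCardEq hcard
  let A : Matrix {i // w i ≠ 0} {i // w i ≠ 0} K := fun i j => M (σ i) j
  have hA : Matrix.diagonal (fun i : {i // w i ≠ 0} => w i) =
      A.transpose * Matrix.diagonal (fun i => w' (σ i)) * A := by
    ext i j
    have h1 := congrFun (congrFun hmat i) j
    rw [Matrix.mul_apply] at h1 ⊢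
    simp only [Matrix.mul_diagonal, Matrix.transpose_apply] at h1 ⊢
    have h3 : ∑ k : Fin n, M k i * w' k * M k j =
        ∑ k : {k // w' k ≠ 0}, M k.1 i * w' k.1 * M k.1 j := by
      have h4 : ∑ k : Fin n with w' k ≠ 0, M k i * w' k * M k j =
          ∑ k : Fin n, M k i * w' k * M k j :=
        Finset.sum_filter_of_ne (by intro k _ hk h0; simp [h0] at hk)
      rw [← h4]
      exact Finset.sum_subtype _ (by simp) _
    rw [h3, ← Equiv.sum_comp σ] at h1
    simpa [Matrix.diagonal_apply, A, Subtype.ext_iff] using h1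
  have hdetA := congrArg Matrix.det hA
  simp only [Matrix.det_mul, Matrix.det_transpose, Matrix.det_diagonal] at hdetA
  have e1 : nonzeroProd w = ∏ i : {i // w i ≠ 0}, w i := by
    rw [nonzeroProd]
    exact Finset.prod_subtype _ (by simp) _
  have e2 : nonzeroProd w' = ∏ i : {i // w i ≠ 0}, w' (σ i) := by
    rw [Equiv.prod_comp σ (fun k => w' k), nonzeroProd]
    exact Finset.prod_subtype _ (by simp) _
  refine ⟨A.det, ?_, ?_⟩
  · intro h0
    rw [h0, zero_mul, zero_mul] at hdetA
    exact (Finset.prod_ne_zero_iff.mpr (fun i _ => i.2)) hdetA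
  · rw [e1, e2, hdetA]; ring

open Classical in
/-- The sign can be computed from any diagonalization. -/
theorem sign_eq [Fintype K] (h2 : (2 : K) ≠ 0) (f : QuadraticForm K V)
    {w : Fin (Module.finrank K V) → K} (hw : IsDiagonalization f w) :
    sign f = quadraticChar K (nonzeroProd w) := by
  have h : ∃ w, IsDiagonalization f w := ⟨w, hw⟩
  obtain ⟨c, hc, he⟩ := nonzeroProd_eq_sq_mul h2 (h.choose_spec.symm.trans hw)
  rw [sign, dif_pos h, he, map_mul, quadraticChar_sq_one' hc, one_mul]

/-- The number `e₀` attached to a quadratic form `f` over `𝔽_p`, `p` odd, on a space of dimension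
`n`: it is `n - (R + 1) / 2` if the rank `R` is odd, and `n - R / 2` or `n - (R + 2) / 2` if `R` is
even and the sign is `(-1) ^ (R (p - 1) / 4)` or its negative. All divisions are exact, and the
subtractions do not truncate when `R ≥ 2`. -/
def e₀ {p : ℕ} [Fact p.Prime] {V : Type*} [AddCommGroup V] [Module (ZMod p) V]
    (f : QuadraticForm (ZMod p) V) : ℕ :=
  if Odd (rank f) then Module.finrank (ZMod p) V - (rank f + 1) / 2
  else if sign f = (-1) ^ (rank f * (p - 1) / 4) then Module.finrank (ZMod p) V - rank f / 2
  else Module.finrank (ZMod p) V - (rank f + 2) / 2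

end QuadraticForms

section Codes

variable {K : Type*} [Field K] {ι : Type*}

/-- The support of a subspace `H` of `K ^ ι`: the coordinates at which not all words of `H`
vanish. -/
def supp (H : Submodule K (ι → K)) : Set ι := {i | ∃ c ∈ H, c i ≠ 0}

/-- The `r`-th generalized Hamming weight of a code `C` of finite length: the minimum of the
support sizes of the `r`-dimensional subspaces of `C` (meaningful for `r ≤ dim C`). -/
def ghw (C : Submodule K (ι → K)) (r : ℕ) : ℕ :=
  sInf {m | ∃ H : Submodule K (ι → K), H ≤ C ∧ Module.finrank K H = r ∧ (supp H).ncard = m}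

variable {F₁ F₂ : Type*} [Field F₁] [Field F₂] [Algebra K F₁] [Algebra K F₂]

/-- The form `Tr(X ⊙ Y) = Tr(x₁ y₁) + Tr(x₂ y₂)` on `F₁ × F₂`. -/
def trProd (X Y : F₁ × F₂) : K :=
  Algebra.trace K F₁ (X.1 * Y.1) + Algebra.trace K F₂ (X.2 * Y.2)

/-- The code `C_D = {(Tr(X ⊙ Y))_{Y ∈ D} : X ∈ F₁ × F₂}`, with coordinates indexed by `D`. -/
def code (K : Type*) [Field K] [Algebra K F₁] [Algebra K F₂] (D : Set (F₁ × F₂)) :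
    Submodule K (D → K) where
  carrier := Set.range fun (X : F₁ × F₂) (Y : D) => trProd X (Y : F₁ × F₂)
  zero_mem' := ⟨0, by ext Y; simp [trProd]⟩
  add_mem' := by
    rintro _ _ ⟨X, rfl⟩ ⟨X', rfl⟩
    exact ⟨X + X', by ext Y; simp [trProd, add_mul]; ring⟩
  smul_mem' := by
    rintro c _ ⟨X, rfl⟩
    exact ⟨c • X, by ext Y; simp [trProd, mul_add]⟩

/-- The defining set `D = {(x, y) ≠ (0, 0) : f(x) + Tr(α y) = 0}`. -/
def definingSet (f : QuadraticForm K F₁) (α : F₂) : Set (F₁ × F₂) :=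
  {z | z ≠ (0, 0) ∧ f z.1 + Algebra.trace K F₂ (α * z.2) = 0}

end Codes

end WeightHierarchy

end

/-!
# Weight hierarchy of the code `C_D`

Write `V = F₁ × F₂`, `lam(y) = Tr(α y)`, `Q(x, y) = f(x) + lam(y)`, and let `Z(W)` be the number of
zeros of `Q` in a subspace `W`. An `r`-dimensional subspace of `C_D` comes from an `r`-dimensional
`H ≤ V`, and its support has size `p ^ (s - 1) - Z(H^⊥)`, where `H^⊥` is the complement for the
trace form (`ncard_supp_map`). So `d_r = p ^ (s - 1) - max Z(W)` over the `W` of dimension `s - r`.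

*Upper bound for `Z`.* Counting the pairs `(h, y)` with `h ∈ H`, `Q(y) = 0` and `h ⊥ y` expresses
`Z(H^⊥)` through the hyperplane sections `Z(h^⊥)`, `h ∈ H` (`card_common_zeros`). Here `Z(h^⊥)` has
the average value `p ^ (s - 2)` unless the second component of `h` is a nonzero multiple of `α`; in
that case completing the square bounds it by the largest fibre of `f`. Fibre sizes of `f` come from
quadratic Gauss sums of a diagonalization (`card_eq_of_even_rank`, `card_le_of_odd_rank`). The
result is `Z(W) ≤ p ^ (s - 1 - r) + M`, with `M` independent of `r`.

*Attaining the bound.* If equality holds for one `H`, then each relevant `h ∈ H` has a hyperplane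
section of maximal size, so equality also holds for suitable smaller subspaces
(`exists_card_common_zeros_eq`). It therefore suffices to attain the bound in one large dimension.

*Isotropic subspaces.* For a maximal totally isotropic `I`, the zeros of `f` in `I^⊥` are exactly
`I`, while off `I^⊥` the form is affine and nonconstant on the translates of `I`. Comparing the
resulting count of the zeros of `f` with the Gauss sum count gives `dim I = e₀`
(`exists_isotropic`). The subspace `I × ker lam` consists of zeros of `Q`; this gives part (1), and
in the hyperbolic case (even rank, sign `(-1) ^ (R (p - 1) / 4)`) it also attains the bound. In the
other cases `I^⊥` is larger than `I`, and adjoining to `I × ker lam` a zero of `Q` over a vector of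
`I^⊥` outside `I` attains it.
-/

noncomputable section

namespace WeightHierarchy

open Finset

/-! ### Fibres of diagonal forms by Gauss sums -/

section Gauss

variable {p : ℕ} [Fact p.Prime]

/-- The quadratic Gauss sum over `ZMod p`. -/
def quadGauss (p : ℕ) [Fact p.Prime] : ℂ :=
  gaussSum ((quadraticChar (ZMod p)).ringHomComp (Int.castRingHom ℂ)) ZMod.stdAddChar

theorem ringChar_zmod_ne_two (hp : p ≠ 2) : ringChar (ZMod p) ≠ 2 := by
  rwa [ZMod.ringChar_zmod_n]

theorem two_ne_zero_zmod (hp : p ≠ 2) : (2 : ZMod p) ≠ 0 :=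
  Ring.two_ne_zero (ringChar_zmod_ne_two hp)

theorem quadGauss_sq (hp : p ≠ 2) :
    quadGauss p ^ 2 = (quadraticChar (ZMod p) (-1) : ℂ) * p := by
  have h := gaussSum_sq (R := ZMod p) (R' := ℂ)
    (χ := (quadraticChar (ZMod p)).ringHomComp (Int.castRingHom ℂ)) ?_ ?_
    (ZMod.isPrimitive_stdAddChar p)
  · simpa [quadGauss, ZMod.card] using h
  · rw [MulChar.ringHomComp_ne_one_iff (RingHom.injective_int _)]
    exact quadraticChar_ne_one (ringChar_zmod_ne_two hp)
  · exact (quadraticChar_isQuadratic (ZMod p)).comp _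

/-- `∑ ψ (a x ^ 2) = η(a) g`, where `g` is the quadratic Gauss sum: each `y` has `1 + η(y)` square
roots, and the contribution of the `1` vanishes. -/
theorem sum_stdAddChar_mul_sq (hp : p ≠ 2) {a : ZMod p} (ha : a ≠ 0) :
    ∑ x : ZMod p, ZMod.stdAddChar (a * (x * x)) = (quadraticChar (ZMod p) a : ℂ) * quadGauss p := by
  have h1 : ∀ y : ZMod p, (#{x : ZMod p | x * x = y} : ℂ) = quadraticChar (ZMod p) y + 1 := by
    intro y
    have h := quadraticChar_card_sqrts (ringChar_zmod_ne_two hp) y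
    rw [← Int.cast_one, ← Int.cast_add, ← h]
    norm_cast
    congr 1
    ext x
    simp [sq]
  have h2 : ∑ x : ZMod p, (ZMod.stdAddChar (a * (x * x)) : ℂ) =
      ∑ y : ZMod p, (quadraticChar (ZMod p) y + 1 : ℂ) * ZMod.stdAddChar (a * y) := by
    rw [← Finset.sum_fiberwise univ (fun x : ZMod p => x * x)]
    refine Finset.sum_congr rfl fun y _ => ?_
    rw [Finset.sum_congr rfl (g := fun _ => (ZMod.stdAddChar (a * y) : ℂ)), Finset.sum_const,
      nsmul_eq_mul, h1]
    intro x hx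
    rw [(Finset.mem_filter.1 hx).2]
  have h3 : ∑ y : ZMod p, (ZMod.stdAddChar (a * y) : ℂ) = 0 := by
    have := AddChar.sum_mulShift a (ZMod.isPrimitive_stdAddChar p)
    simpa [ha, mul_comm] using this
  have h4 := gaussSum_mulShift ((quadraticChar (ZMod p)).ringHomComp (Int.castRingHom ℂ))
    ZMod.stdAddChar (Units.mk0 a ha)
  have h5 : (quadraticChar (ZMod p) a : ℂ) * quadraticChar (ZMod p) a = 1 := by
    have := quadraticChar_sq_one (F := ZMod p) ha
    rw [sq] at this
    exact_mod_cast this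
  rw [h2]
  simp only [add_mul, one_mul, Finset.sum_add_distrib, h3, add_zero]
  rw [quadGauss, ← h4, Units.val_mk0, ← mul_assoc]
  simp only [MulChar.ringHomComp_apply, eq_intCast, h5, one_mul, gaussSum, AddChar.mulShift_apply]

theorem addChar_sum {A M ι : Type*} [AddCommMonoid A] [CommMonoid M] (ψ : AddChar A M)
    (s : Finset ι) (g : ι → A) : ψ (∑ i ∈ s, g i) = ∏ i ∈ s, ψ (g i) := by
  classical
  induction s using Finset.induction_on with
  | empty => simp
  | insert a s ha ih => rw [Finset.sum_insert ha, Finset.prod_insert ha, AddChar.map_add_eq_mul, ih]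

/-- The exponential sum of a diagonal form factors into one-variable Gauss sums. -/
theorem sum_stdAddChar_diagonal (hp : p ≠ 2) {n : ℕ} (w : Fin n → ZMod p) {z : ZMod p}
    (hz : z ≠ 0) :
    ∑ x : Fin n → ZMod p, ZMod.stdAddChar (z * QuadraticMap.weightedSumSquares (ZMod p) w x) =
      (quadraticChar (ZMod p) z : ℂ) ^ #{i | w i ≠ 0} *
        quadraticChar (ZMod p) (nonzeroProd w) * quadGauss p ^ #{i | w i ≠ 0} *
        (p : ℂ) ^ (n - #{i | w i ≠ 0}) := by
  have h1 : ∀ x : Fin n → ZMod p,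
      (ZMod.stdAddChar (z * QuadraticMap.weightedSumSquares (ZMod p) w x) : ℂ) =
        ∏ i, ZMod.stdAddChar (z * w i * (x i * x i)) := by
    intro x
    rw [QuadraticMap.weightedSumSquares_apply, Finset.mul_sum, addChar_sum]
    simp [mul_assoc]
  have h2 : ∀ i, ∑ t : ZMod p, (ZMod.stdAddChar (z * w i * (t * t)) : ℂ) =
      if w i ≠ 0 then (quadraticChar (ZMod p) z : ℂ) * quadraticChar (ZMod p) (w i) * quadGauss p
      else (p : ℂ) := by
    intro i
    split_ifs with hi
    · rw [sum_stdAddChar_mul_sq hp (mul_ne_zero hz hi), map_mul]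
      push_cast
      ring
    · simp [not_not.1 hi, ZMod.card]
  rw [Finset.sum_congr rfl fun x _ => h1 x]
  have h3 := Finset.prod_univ_sum (fun _ : Fin n => (univ : Finset (ZMod p)))
    (fun i t => (ZMod.stdAddChar (z * w i * (t * t)) : ℂ))
  rw [Fintype.piFinset_univ] at h3
  rw [← h3, Finset.prod_congr rfl fun i _ => h2 i, Finset.prod_ite, Finset.prod_const,
    Finset.prod_mul_distrib, Finset.prod_mul_distrib, Finset.prod_const, Finset.prod_const]
  have h4 : #{i | ¬ w i ≠ 0} = n - #{i | w i ≠ 0} := by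
    have := Finset.card_filter_add_card_filter_not (s := (univ : Finset (Fin n)))
      (fun i => w i ≠ 0)
    rw [Finset.card_univ, Fintype.card_fin] at this
    omega
  rw [h4, nonzeroProd, map_prod]
  push_cast
  ring_nf

theorem card_mul_eq_sum_stdAddChar {ι : Type*} [Fintype ι] (g : ι → ZMod p) (c : ZMod p) :
    (p : ℂ) * #{x | g x = c} =
      ∑ z : ZMod p, ZMod.stdAddChar (-(z * c)) * ∑ x, ZMod.stdAddChar (z * g x) := by
  simp only [Finset.mul_sum, ← AddChar.map_add_eq_mul]
  rw [Finset.sum_comm]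
  have h : ∀ x, ∑ z : ZMod p, (ZMod.stdAddChar (-(z * c) + z * g x) : ℂ) =
      if g x = c then (p : ℂ) else 0 := by
    intro x
    have := AddChar.sum_mulShift (g x - c) (ZMod.isPrimitive_stdAddChar p)
    simp only [sub_eq_zero, ZMod.card, Nat.cast_ite, Nat.cast_zero] at this
    rw [← this]
    refine Finset.sum_congr rfl fun z _ => ?_
    congr 1
    ring
  rw [Finset.sum_congr rfl fun x _ => h x, ← Finset.sum_filter, Finset.sum_const, nsmul_eq_mul,
    mul_comm]

/-- A diagonal form with an even number of nonzero coefficients: number of solutions of `q = c`. -/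
theorem card_diagonal_even (hp : p ≠ 2) {n m : ℕ} (w : Fin n → ZMod p)
    (hm : #{i | w i ≠ 0} = 2 * m) (c : ZMod p) :
    (p : ℤ) * #{x | QuadraticMap.weightedSumSquares (ZMod p) w x = c} = (p : ℤ) ^ n +
      quadraticChar (ZMod p) (nonzeroProd w) * quadraticChar (ZMod p) (-1) ^ m *
        (p : ℤ) ^ (n - m) * (if c = 0 then (p : ℤ) - 1 else -1) := by
  have hle : 2 * m ≤ n := by
    rw [← hm]
    exact (Finset.card_le_univ _).trans (by simp)
  have key : ∀ z ∈ univ.erase (0 : ZMod p), (ZMod.stdAddChar (-(z * c)) : ℂ) *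
      ∑ x, ZMod.stdAddChar (z * QuadraticMap.weightedSumSquares (ZMod p) w x) =
      (quadraticChar (ZMod p) (nonzeroProd w) * quadraticChar (ZMod p) (-1) ^ m *
        (p : ℂ) ^ (n - m)) * ZMod.stdAddChar (z * (-c)) := by
    intro z hz
    have hz := Finset.ne_of_mem_erase hz
    rw [sum_stdAddChar_diagonal hp w hz, hm, pow_mul, pow_mul, quadGauss_sq hp,
      show n - m = m + (n - 2 * m) by omega, pow_add, mul_neg]
    have : (quadraticChar (ZMod p) z : ℂ) ^ 2 = 1 := by
      exact_mod_cast quadraticChar_sq_one (F := ZMod p) hz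
    rw [this, one_pow]
    ring
  have h1 : ∑ z ∈ univ.erase (0 : ZMod p), (ZMod.stdAddChar (z * (-c)) : ℂ) =
      if c = 0 then (p : ℂ) - 1 else -1 := by
    have h2 := AddChar.sum_mulShift (-c) (ZMod.isPrimitive_stdAddChar p)
    simp only [neg_eq_zero, ZMod.card, Nat.cast_ite, Nat.cast_zero] at h2
    rw [Finset.sum_erase_eq_sub (mem_univ _), h2, zero_mul, AddChar.map_zero_eq_one]
    split_ifs <;> ring
  have h := card_mul_eq_sum_stdAddChar (QuadraticMap.weightedSumSquares (ZMod p) w) c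
  rw [← Finset.add_sum_erase _ _ (mem_univ (0 : ZMod p)), Finset.sum_congr rfl key,
    ← Finset.mul_sum, h1] at h
  simp only [zero_mul, neg_zero, AddChar.map_zero_eq_one, one_mul, Finset.sum_const,
    Finset.card_univ, Fintype.card_fun, ZMod.card, Fintype.card_fin, nsmul_eq_mul, mul_one,
    Nat.cast_pow] at h
  have h' : (((p : ℤ) * #{x | QuadraticMap.weightedSumSquares (ZMod p) w x = c} : ℤ) : ℂ) =
    ((p : ℤ) ^ n + quadraticChar (ZMod p) (nonzeroProd w) * quadraticChar (ZMod p) (-1) ^ m *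
        (p : ℤ) ^ (n - m) * (if c = 0 then (p : ℤ) - 1 else -1) : ℤ) := by
    push_cast
    exact h
  exact_mod_cast h'

/-- A diagonal form with an odd number of nonzero coefficients: number of solutions of `q = c`. -/
theorem card_diagonal_odd (hp : p ≠ 2) {n m : ℕ} (w : Fin n → ZMod p)
    (hm : #{i | w i ≠ 0} = 2 * m + 1) (c : ZMod p) :
    (p : ℤ) * #{x | QuadraticMap.weightedSumSquares (ZMod p) w x = c} = (p : ℤ) ^ n +
      quadraticChar (ZMod p) (nonzeroProd w) * quadraticChar (ZMod p) (-1) ^ (m + 1) *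
        (p : ℤ) ^ (n - m) * quadraticChar (ZMod p) (-c) := by
  have hle : 2 * m + 1 ≤ n := by
    rw [← hm]
    exact (Finset.card_le_univ _).trans (by simp)
  have key : ∀ z ∈ univ.erase (0 : ZMod p), (ZMod.stdAddChar (-(z * c)) : ℂ) *
      ∑ x, ZMod.stdAddChar (z * QuadraticMap.weightedSumSquares (ZMod p) w x) =
      (quadraticChar (ZMod p) (nonzeroProd w) * quadGauss p ^ (2 * m + 1) *
        (p : ℂ) ^ (n - (2 * m + 1))) *
        ((quadraticChar (ZMod p) z : ℂ) * ZMod.stdAddChar (z * (-c))) := by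
    intro z hz
    have hz := Finset.ne_of_mem_erase hz
    rw [sum_stdAddChar_diagonal hp w hz, hm, mul_neg, pow_succ (quadraticChar (ZMod p) z : ℂ),
      pow_mul (quadraticChar (ZMod p) z : ℂ)]
    have : (quadraticChar (ZMod p) z : ℂ) ^ 2 = 1 := by
      exact_mod_cast quadraticChar_sq_one (F := ZMod p) hz
    rw [this, one_pow]
    ring
  have h1 : ∑ z ∈ univ.erase (0 : ZMod p),
      ((quadraticChar (ZMod p) z : ℂ) * ZMod.stdAddChar (z * (-c))) =
      (quadraticChar (ZMod p) (-c) : ℂ) * quadGauss p := by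
    rw [Finset.sum_erase _ (by simp)]
    by_cases hc : c = 0
    · have := quadraticChar_sum_zero (F := ZMod p) (ringChar_zmod_ne_two hp)
      simp only [hc, neg_zero, mul_zero, AddChar.map_zero_eq_one, mul_one, quadraticChar_zero,
        Int.cast_zero, zero_mul]
      exact_mod_cast this
    have h4 := gaussSum_mulShift ((quadraticChar (ZMod p)).ringHomComp (Int.castRingHom ℂ))
      ZMod.stdAddChar (Units.mk0 (-c) (neg_ne_zero.2 hc))
    have h5 : (quadraticChar (ZMod p) (-c) : ℂ) * quadraticChar (ZMod p) (-c) = 1 := by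
      have := quadraticChar_sq_one (F := ZMod p) (neg_ne_zero.2 hc)
      rw [sq] at this
      exact_mod_cast this
    rw [quadGauss, ← h4, Units.val_mk0, ← mul_assoc]
    simp only [MulChar.ringHomComp_apply, eq_intCast, h5, one_mul, gaussSum,
      AddChar.mulShift_apply]
    exact Finset.sum_congr rfl fun z _ => by rw [mul_comm z]
  have h := card_mul_eq_sum_stdAddChar (QuadraticMap.weightedSumSquares (ZMod p) w) c
  rw [← Finset.add_sum_erase _ _ (mem_univ (0 : ZMod p)), Finset.sum_congr rfl key,
    ← Finset.mul_sum, h1] at h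
  simp only [zero_mul, neg_zero, AddChar.map_zero_eq_one, one_mul, Finset.sum_const,
    Finset.card_univ, Fintype.card_fun, ZMod.card, Fintype.card_fin, nsmul_eq_mul, mul_one,
    Nat.cast_pow] at h
  have h2 : quadGauss p ^ (2 * m + 1) * quadGauss p =
      (quadraticChar (ZMod p) (-1) : ℂ) ^ (m + 1) * (p : ℂ) ^ (m + 1) := by
    rw [← pow_succ, show 2 * m + 1 + 1 = 2 * (m + 1) by ring, pow_mul, quadGauss_sq hp, mul_pow]
  have h' : (((p : ℤ) * #{x | QuadraticMap.weightedSumSquares (ZMod p) w x = c} : ℤ) : ℂ) =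
    ((p : ℤ) ^ n + quadraticChar (ZMod p) (nonzeroProd w) *
      quadraticChar (ZMod p) (-1) ^ (m + 1) * (p : ℤ) ^ (n - m) *
        quadraticChar (ZMod p) (-c) : ℤ) := by
    push_cast
    rw [h, show n - m = (m + 1) + (n - (2 * m + 1)) by omega, pow_add (p : ℂ) (m + 1)]
    linear_combination (quadraticChar (ZMod p) (nonzeroProd w) : ℂ) *
      (p : ℂ) ^ (n - (2 * m + 1)) * (quadraticChar (ZMod p) (-c) : ℂ) * h2
  exact_mod_cast h'

end Gauss

/-! ### Rank and fibres of a quadratic form -/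

section Rank

variable {K : Type*} [Field K] {V : Type*} [AddCommGroup V] [Module K V]

theorem ker_bilin (h2 : (2 : K) ≠ 0) (f : QuadraticForm K V) :
    LinearMap.ker (bilin f) = LinearMap.ker (QuadraticMap.polarBilin f) := by
  ext x
  simp [bilin, LinearMap.ker_smul _ _ (inv_ne_zero h2)]

theorem finrank_ker_polarBilin (h2 : (2 : K) ≠ 0) [FiniteDimensional K V]
    (f : QuadraticForm K V) :
    rank f + Module.finrank K (LinearMap.ker (QuadraticMap.polarBilin f)) = Module.finrank K V := by
  rw [← ker_bilin h2, rank, LinearMap.finrank_range_add_finrank_ker]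

open Classical in
theorem rank_eq_card (h2 : (2 : K) ≠ 0) [FiniteDimensional K V] (f : QuadraticForm K V)
    {w : Fin (Module.finrank K V) → K} (hw : IsDiagonalization f w) :
    rank f = #{i | w i ≠ 0} := by
  obtain ⟨e⟩ := hw
  have hpolar : ∀ x y, QuadraticMap.polar f x y = 2 * ∑ i, w i * e x i * e y i := by
    intro x y
    simp only [QuadraticMap.polar, ← e.map_app]
    rw [show e (x + y) = e x + e y from map_add e.toLinearEquiv x y]
    simp only [QuadraticMap.weightedSumSquares_apply, smul_eq_mul, Pi.add_apply, Finset.mul_sum,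
      ← Finset.sum_sub_distrib]
    exact Finset.sum_congr rfl fun i _ => by ring
  have hker : LinearMap.ker (QuadraticMap.polarBilin f) =
      LinearMap.ker ((Matrix.toLin' (Matrix.diagonal w)) ∘ₗ
        (e.toLinearEquiv : V →ₗ[K] (Fin (Module.finrank K V) → K))) := by
    ext x
    simp only [LinearMap.mem_ker]
    constructor
    · intro h
      ext i
      obtain ⟨y, hy⟩ := e.toLinearEquiv.surjective (Pi.single i 1)
      have h1 := LinearMap.congr_fun h y
      rw [QuadraticMap.polarBilin_apply_apply, hpolar, LinearMap.zero_apply] at h1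
      change e y = _ at hy
      rw [hy] at h1
      have h3 := (mul_eq_zero.1 h1).resolve_left h2
      rw [Finset.sum_eq_single i (by intro j _ hj; simp [hj]) (by simp)] at h3
      simpa [Matrix.mulVec_diagonal] using h3
    · intro h
      ext y
      rw [QuadraticMap.polarBilin_apply_apply, hpolar, LinearMap.zero_apply]
      have h1 : ∀ i, w i * e x i = 0 := by
        intro i
        have := congrFun h i
        simpa [Matrix.mulVec_diagonal] using this
      simp [h1]
  have h1 := finrank_ker_polarBilin h2 f
  rw [hker] at h1
  have h3 := LinearMap.finrank_range_add_finrank_ker ((Matrix.toLin' (Matrix.diagonal w)) ∘ₗ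
        (e.toLinearEquiv : V →ₗ[K] (Fin (Module.finrank K V) → K)))
  rw [LinearMap.range_comp_of_range_eq_top _ (LinearEquiv.range _)] at h3
  have h4 := Matrix.rank_diagonal w
  rw [Matrix.rank, ← Matrix.toLin'_apply', Fintype.card_subtype] at h4
  omega

end Rank

section Count

variable {p : ℕ} [Fact p.Prime] {V : Type*} [AddCommGroup V] [Module (ZMod p) V] [Fintype V]

theorem card_eq_card_of_equivalent {W : Type*} [AddCommGroup W] [Module (ZMod p) W] [Fintype W]
    {f : QuadraticForm (ZMod p) V} {q : QuadraticForm (ZMod p) W} (h : f.Equivalent q)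
    (c : ZMod p) : #{x | f x = c} = #{x | q x = c} := by
  obtain ⟨e⟩ := h
  refine Finset.card_equiv e.toLinearEquiv.toEquiv fun x => ?_
  simp only [Finset.mem_filter, Finset.mem_univ, true_and]
  rw [← e.map_app]
  rfl

theorem quadraticChar_neg_one_pow (hp : p ≠ 2) (m : ℕ) :
    quadraticChar (ZMod p) (-1) ^ m = (-1) ^ (2 * m * (p - 1) / 4) := by
  have hodd : p % 2 = 1 := (Fact.out : p.Prime).eq_two_or_odd.resolve_left hp
  rw [quadraticChar_neg_one (ringChar_zmod_ne_two hp), ZMod.card, ZMod.χ₄_eq_neg_one_pow hodd,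
    ← pow_mul]
  congr 1
  obtain ⟨k, hk⟩ : ∃ k, p = 2 * k + 1 := ⟨p / 2, by omega⟩
  subst hk
  rw [show (2 * k + 1) / 2 = k by omega, show 2 * m * (2 * k + 1 - 1) = 4 * (k * m) by
    rw [Nat.add_sub_cancel]; ring]
  omega

theorem card_eq_of_even_rank (hp : p ≠ 2) (f : QuadraticForm (ZMod p) V) {m : ℕ}
    (hm : rank f = 2 * m) (c : ZMod p) :
    (p : ℤ) * #{x | f x = c} = (p : ℤ) ^ Module.finrank (ZMod p) V +
      sign f * (-1) ^ (rank f * (p - 1) / 4) *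
        (p : ℤ) ^ (Module.finrank (ZMod p) V - m) * (if c = 0 then (p : ℤ) - 1 else -1) := by
  have h2 := two_ne_zero_zmod hp
  obtain ⟨w, hw⟩ := exists_isDiagonalization h2 f
  rw [card_eq_card_of_equivalent hw, sign_eq h2 f hw, hm, ← quadraticChar_neg_one_pow hp,
    card_diagonal_even hp w (m := m)]
  · congr!
  · rw [rank_eq_card h2 f hw] at hm
    convert hm

theorem card_zero_of_odd_rank (hp : p ≠ 2) (f : QuadraticForm (ZMod p) V) (hR : Odd (rank f)) :
    (p : ℤ) * #{x | f x = 0} = (p : ℤ) ^ Module.finrank (ZMod p) V := by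
  have h2 := two_ne_zero_zmod hp
  obtain ⟨w, hw⟩ := exists_isDiagonalization h2 f
  obtain ⟨m, hm⟩ := hR
  rw [card_eq_card_of_equivalent hw, card_diagonal_odd hp w (m := m)]
  · simp
  · rw [rank_eq_card h2 f hw] at hm
    convert hm

theorem card_le_of_odd_rank (hp : p ≠ 2) (f : QuadraticForm (ZMod p) V) {m : ℕ}
    (hm : rank f = 2 * m + 1) (c : ZMod p) :
    (p : ℤ) * #{x | f x = c} ≤
      (p : ℤ) ^ Module.finrank (ZMod p) V + (p : ℤ) ^ (Module.finrank (ZMod p) V - m) := by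
  have h2 := two_ne_zero_zmod hp
  obtain ⟨w, hw⟩ := exists_isDiagonalization h2 f
  rw [card_eq_card_of_equivalent hw, card_diagonal_odd hp w (m := m)]
  · have hη : ∀ a : ZMod p, |quadraticChar (ZMod p) a| ≤ 1 := by
      intro a
      rcases quadraticChar_isQuadratic (ZMod p) a with h | h | h <;> simp [h]
    rw [add_le_add_iff_left]
    refine (le_abs_self _).trans ?_
    rw [abs_mul, abs_mul, abs_mul, abs_pow, abs_of_nonneg (a := (p : ℤ) ^ _) (by positivity)]
    have h1 := mul_le_one₀ (hη (nonzeroProd w)) (by positivity)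
      (pow_le_one₀ (n := m + 1) (abs_nonneg _) (hη (-1)))
    calc _ ≤ 1 * (p : ℤ) ^ (Module.finrank (ZMod p) V - m) * 1 := by
          gcongr
          exact hη _
      _ = _ := by ring
  · rw [rank_eq_card h2 f hw] at hm
    convert hm

theorem sign_eq_one_or (hp : p ≠ 2) (f : QuadraticForm (ZMod p) V) : sign f = 1 ∨ sign f = -1 := by
  have h2 := two_ne_zero_zmod hp
  obtain ⟨w, hw⟩ := exists_isDiagonalization h2 f
  rw [sign_eq h2 f hw]
  refine @quadraticChar_dichotomy _ _ _ (Classical.decEq _) _ ?_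
  exact Finset.prod_ne_zero_iff.2 fun i hi => by simpa using hi

end Count

/-! ### Equidistribution and isotropic subspaces -/

section Equidistribution

open scoped Classical

variable {p : ℕ} [Fact p.Prime] {V : Type*} [AddCommGroup V] [Module (ZMod p) V] [Fintype V]

theorem card_space : Fintype.card V = p ^ Module.finrank (ZMod p) V := by
  have h := Module.card_eq_pow_finrank (K := ZMod p) (V := V)
  have hc : Fintype.card (ZMod p) = p := ZMod.card p
  simpa only [hc] using h

theorem card_submodule (U : Submodule (ZMod p) V) :
    #{u | u ∈ U} = p ^ Module.finrank (ZMod p) U := by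
  rw [← card_space (p := p) (V := U), ← Fintype.card_subtype]

theorem card_filter_linear_eq (U : Submodule (ZMod p) V) (ψ : V →ₗ[ZMod p] ZMod p)
    (hψ : ∃ u ∈ U, ψ u ≠ 0) (c : ZMod p) :
    p * #{u | u ∈ U ∧ ψ u = c} = #{u | u ∈ U} := by
  obtain ⟨u₀, hu₀, h0⟩ := hψ
  have h1 : ∀ c', #{u | u ∈ U ∧ ψ u = c'} = #{u | u ∈ U ∧ ψ u = c} := by
    intro c'
    refine Finset.card_equiv (Equiv.addRight (((c - c') / ψ u₀) • u₀)) fun u => ?_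
    simp only [Finset.mem_filter, Finset.mem_univ, true_and, Equiv.coe_addRight, map_add, map_smul,
      smul_eq_mul, div_mul_cancel₀ _ h0]
    rw [Submodule.add_mem_iff_left _ (U.smul_mem _ hu₀)]
    refine and_congr_right fun _ => ?_
    constructor
    · rintro rfl; ring
    · intro h; linear_combination h
  have h2 := Finset.card_eq_sum_card_fiberwise (s := {u | u ∈ U}) (t := univ) (f := ψ)
    (fun _ _ => by simp)
  simp only [Finset.filter_filter, h1, Finset.sum_const, Finset.card_univ, ZMod.card,
    smul_eq_mul] at h2
  exact h2.symm

/-- If translating by the subspace `U` preserves `S`, and `g` restricted to each translate of `U`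
inside `S` is affine and nonconstant, then `g` takes every value equally often on `S`. -/
theorem card_filter_eq_of_affine (U : Submodule (ZMod p) V) (S : V → Prop) [DecidablePred S]
    (g : V → ZMod p)
    (φ : V → V →ₗ[ZMod p] ZMod p) (hS : ∀ x, S x → ∀ u ∈ U, S (x + u))
    (hg : ∀ x, S x → ∀ u ∈ U, g (x + u) = g x + φ x u) (hφ : ∀ x, S x → ∃ u ∈ U, φ x u ≠ 0)
    (c : ZMod p) : p * #{x | S x ∧ g x = c} = #{x | S x} := by
  have hpos : 0 < #{u | u ∈ U} := Finset.card_pos.2 ⟨0, by simp⟩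
  have h1 : ∑ u ∈ {u | u ∈ U}, #{x | S x ∧ g (x + u) = c} =
      ∑ u ∈ {u | u ∈ U}, #{x | S x ∧ g x = c} := by
    refine Finset.sum_congr rfl fun u hu => ?_
    have hu : u ∈ U := by simpa using hu
    refine Finset.card_equiv (Equiv.addRight u) fun x => ?_
    simp only [Finset.mem_filter, Finset.mem_univ, true_and, Equiv.coe_addRight]
    refine and_congr_left fun _ => ⟨fun h => hS x h u hu, fun h => ?_⟩
    simpa using hS _ h (-u) (U.neg_mem hu)
  have h2 : ∑ u ∈ {u | u ∈ U}, #{x | S x ∧ g (x + u) = c} =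
      ∑ x ∈ {x | S x}, #{u | u ∈ U ∧ g (x + u) = c} := by
    have := Finset.sum_card_bipartiteAbove_eq_sum_card_bipartiteBelow
      (s := ({u | u ∈ U} : Finset V)) (t := ({x | S x} : Finset V)) (fun u x => g (x + u) = c)
    simpa only [Finset.bipartiteAbove, Finset.bipartiteBelow, Finset.filter_filter] using this
  have h3 : ∀ x ∈ ({x | S x} : Finset V), p * #{u | u ∈ U ∧ g (x + u) = c} = #{u | u ∈ U} := by
    intro x hx
    have hx : S x := by simpa using hx
    rw [← card_filter_linear_eq U (φ x) (hφ x hx) (c - g x)]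
    congr 2
    ext u
    simp only [Finset.mem_filter, Finset.mem_univ, true_and]
    refine and_congr_right fun hu => ?_
    rw [hg x hx u hu, eq_sub_iff_add_eq, add_comm]
  rw [h1, Finset.sum_const, smul_eq_mul] at h2
  have h4 := congrArg (p * ·) h2
  simp only [Finset.mul_sum] at h4
  rw [Finset.sum_congr rfl h3, Finset.sum_const, smul_eq_mul] at h4
  refine Nat.eq_of_mul_eq_mul_left hpos ?_
  rw [← mul_comm #{x | S x}, ← h4]
  ring

end Equidistribution

section Isotropic

open scoped Classical

variable {p : ℕ} [Fact p.Prime] {V : Type*} [AddCommGroup V] [Module (ZMod p) V]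

theorem quadraticForm_add_smul (f : QuadraticForm (ZMod p) V) (x y : V) (t : ZMod p) :
    f (x + t • y) = f x + t * QuadraticMap.polar f x y + t ^ 2 * f y := by
  have h : f (x + t • y) = f x + f (t • y) + QuadraticMap.polar f x (t • y) := by
    rw [QuadraticMap.polar]; ring
  rw [h, QuadraticMap.polar_smul_right, QuadraticMap.map_smul]
  simp only [smul_eq_mul]
  ring

theorem mem_orthogonal_polarBilin {f : QuadraticForm (ZMod p) V} {I : Submodule (ZMod p) V}
    {x : V} : x ∈ LinearMap.BilinForm.orthogonal (QuadraticMap.polarBilin f) I ↔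
      ∀ i ∈ I, QuadraticMap.polar f i x = 0 := Iff.rfl

variable [Fintype V]

/-- Every quadratic form has a maximal totally isotropic subspace. It contains the radical, and
the only isotropic vectors orthogonal to it are its own. -/
theorem exists_maximal_isotropic (hp : p ≠ 2) (f : QuadraticForm (ZMod p) V) :
    ∃ I : Submodule (ZMod p) V, (∀ x ∈ I, f x = 0) ∧
      LinearMap.ker (QuadraticMap.polarBilin f) ≤ I ∧
      ∀ x, (∀ i ∈ I, QuadraticMap.polar f i x = 0) → f x = 0 → x ∈ I := by
  obtain ⟨I, hI⟩ := (Set.toFinite {I : Submodule (ZMod p) V | ∀ x ∈ I, f x = 0}).exists_maximal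
    ⟨⊥, by simp⟩
  have hmax : ∀ x, (∀ i ∈ I, QuadraticMap.polar f i x = 0) → f x = 0 → x ∈ I := by
    intro x hx hfx
    have hle : I ⊔ Submodule.span (ZMod p) {x} ≤ I := by
      refine hI.2 ?_ le_sup_left
      intro y hy
      obtain ⟨i, hi, z, hz, rfl⟩ := Submodule.mem_sup.1 hy
      obtain ⟨t, rfl⟩ := Submodule.mem_span_singleton.1 hz
      rw [quadraticForm_add_smul, hx i hi, hfx, hI.1 i hi]
      ring
    exact hle (Submodule.mem_sup_right (Submodule.mem_span_singleton_self x))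
  refine ⟨I, hI.1, fun x hx => ?_, hmax⟩
  have h : ∀ y, QuadraticMap.polar f x y = 0 := fun y => LinearMap.congr_fun hx y
  refine hmax x (fun i _ => by rw [QuadraticMap.polar_comm, h]) ?_
  have := h x
  rw [QuadraticMap.polar_self, two_smul, ← two_mul] at this
  exact (mul_eq_zero.1 this).resolve_left (two_ne_zero_zmod hp)

theorem finrank_orthogonal_polarBilin (hp : p ≠ 2) (f : QuadraticForm (ZMod p) V)
    {I : Submodule (ZMod p) V} (hI : LinearMap.ker (QuadraticMap.polarBilin f) ≤ I) :
    Module.finrank (ZMod p) I +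
      Module.finrank (ZMod p) (LinearMap.BilinForm.orthogonal (QuadraticMap.polarBilin f) I) +
        rank f = 2 * Module.finrank (ZMod p) V := by
  have hrefl : LinearMap.BilinForm.IsRefl (QuadraticMap.polarBilin f) := by
    intro x y h
    rw [QuadraticMap.polarBilin_apply_apply] at h ⊢
    rw [QuadraticMap.polar_comm, h]
  have h1 := LinearMap.BilinForm.finrank_add_finrank_orthogonal hrefl I
  have h2 : I ⊓ LinearMap.BilinForm.orthogonal (QuadraticMap.polarBilin f) ⊤ =
      LinearMap.ker (QuadraticMap.polarBilin f) := by
    rw [← inf_eq_right.2 hI]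
    congr 1
    ext x
    rw [mem_orthogonal_polarBilin, LinearMap.mem_ker]
    constructor
    · intro h
      ext y
      rw [QuadraticMap.polarBilin_apply_apply, QuadraticMap.polar_comm]
      exact h y trivial
    · intro h y _
      rw [QuadraticMap.polar_comm]
      exact LinearMap.congr_fun h y
  have h3 := finrank_ker_polarBilin (two_ne_zero_zmod hp) f
  rw [h2] at h1
  omega

/-- Off the orthogonal complement of a totally isotropic subspace `I`, the form is affine and
nonconstant on the translates of `I`. This counts its zeros when `I` is maximal. -/
theorem card_zero_of_maximal_isotropic (f : QuadraticForm (ZMod p) V)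
    {I : Submodule (ZMod p) V} (hI : ∀ x ∈ I, f x = 0)
    (hmax : ∀ x, (∀ i ∈ I, QuadraticMap.polar f i x = 0) → f x = 0 → x ∈ I) :
    p * #{x | f x = 0} + p ^ Module.finrank (ZMod p)
        (LinearMap.BilinForm.orthogonal (QuadraticMap.polarBilin f) I) =
      p ^ (Module.finrank (ZMod p) I + 1) + p ^ Module.finrank (ZMod p) V := by
  set J := LinearMap.BilinForm.orthogonal (QuadraticMap.polarBilin f) I with hJ
  have hIJ : I ≤ J := by
    intro x hx i hi
    change QuadraticMap.polar f i x = 0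
    rw [QuadraticMap.polar, hI _ (I.add_mem hi hx), hI i hi, hI x hx]
    simp
  have h1 : p * #{x | x ∉ J ∧ f x = 0} = #{x | x ∉ J} := by
    refine card_filter_eq_of_affine I (fun x => x ∉ J) f (QuadraticMap.polarBilin f) ?_ ?_ ?_ 0
    · intro x hx u hu h
      exact hx ((Submodule.add_mem_iff_left _ (hIJ hu)).1 h)
    · intro x _ u hu
      have := quadraticForm_add_smul f x u 1
      simpa [hI u hu] using this
    · intro x hx
      by_contra! h
      refine hx fun i hi => ?_
      change QuadraticMap.polar f i x = 0
      rw [QuadraticMap.polar_comm]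
      exact h i hi
  have h2 : #{x | f x = 0} = #{x | x ∈ I} + #{x | x ∉ J ∧ f x = 0} := by
    rw [← Finset.card_filter_add_card_filter_not (s := {x | f x = 0}) (fun x => x ∈ J),
      Finset.filter_filter, Finset.filter_filter]
    congr 2
    · ext x
      simp only [Finset.mem_filter, Finset.mem_univ, true_and]
      exact ⟨fun h => hmax x h.2 h.1, fun h => ⟨hI x h, hIJ h⟩⟩
    · ext x
      simp only [Finset.mem_filter, Finset.mem_univ, true_and]
      exact and_comm
  have h3 := Finset.card_filter_add_card_filter_not (s := (univ : Finset V)) (fun x => x ∈ J)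
  rw [Finset.card_univ, card_space (p := p), card_submodule] at h3
  rw [card_submodule] at h2
  rw [h2, mul_add, h1, pow_succ, ← h3]
  ring

/-- A totally isotropic subspace of dimension `e₀ f`. Counting the zeros of `f` in two ways, by
`card_zero_of_maximal_isotropic` and by Gauss sums, determines the dimension of every maximal one,
and shows that it differs from its orthogonal complement unless the rank is even and the sign is
`(-1) ^ (R (p - 1) / 4)`. -/
theorem exists_isotropic (hp : p ≠ 2) (f : QuadraticForm (ZMod p) V) :
    ∃ I : Submodule (ZMod p) V, (∀ x ∈ I, f x = 0) ∧ Module.finrank (ZMod p) I = e₀ f ∧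
      ((Odd (rank f) ∨ sign f ≠ (-1) ^ (rank f * (p - 1) / 4)) →
        ∃ b ∉ I, ∀ i ∈ I, QuadraticMap.polar f i b = 0) := by
  obtain ⟨I, hI, hker, hmax⟩ := exists_maximal_isotropic hp f
  have h1 := finrank_orthogonal_polarBilin hp f hker
  have h2 := card_zero_of_maximal_isotropic f hI hmax
  have hp2 : 3 ≤ p := by
    have := (Fact.out : p.Prime).two_le
    omega
  set J := LinearMap.BilinForm.orthogonal (QuadraticMap.polarBilin f) I with hJ
  set e := Module.finrank (ZMod p) I
  set e' := Module.finrank (ZMod p) J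
  set n := Module.finrank (ZMod p) V
  -- a vector orthogonal to `I` outside `I` exists as soon as the dimensions differ
  have hb : e < e' → ∃ b ∉ I, ∀ i ∈ I, QuadraticMap.polar f i b = 0 := by
    intro hlt
    by_contra! h
    have hle : J ≤ I := by
      intro x hx
      by_contra hxI
      obtain ⟨i, hi, hne⟩ := h x hxI
      exact hne (hx i hi)
    exact absurd (Submodule.finrank_mono hle) (by omega)
  have hIJ : e ≤ e' := by
    refine Submodule.finrank_mono fun x hx i hi => ?_
    change QuadraticMap.polar f i x = 0
    rw [QuadraticMap.polar, hI _ (I.add_mem hi hx), hI i hi, hI x hx]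
    simp
  have h2' : (p : ℤ) * #{x | f x = 0} + (p : ℤ) ^ e' = (p : ℤ) ^ (e + 1) + (p : ℤ) ^ n := by
    exact_mod_cast h2
  rcases Nat.even_or_odd (rank f) with hev | hodd
  · obtain ⟨m, hm⟩ := hev.two_dvd
    have h3 := card_eq_of_even_rank hp f hm 0
    rw [if_pos rfl] at h3
    change _ = (p : ℤ) ^ n + _ * (p : ℤ) ^ (n - m) * _ at h3
    have hno : ¬ Odd (rank f) := Nat.not_odd_iff_even.2 hev
    obtain ⟨j, hj, hj'⟩ : ∃ j, n - m = e + j ∧ e' = e + 2 * j := ⟨n - m - e, by omega, by omega⟩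
    -- compare powers of `p`: the dimension of `I` falls short of `n - m` by `0` or `1`
    have h4 : (p : ℤ) ^ e * p - (p : ℤ) ^ e * ((p : ℤ) ^ j * (p : ℤ) ^ j) =
        sign f * (-1) ^ (rank f * (p - 1) / 4) * ((p : ℤ) ^ e * (p : ℤ) ^ j) * ((p : ℤ) - 1) := by
      rw [hj, pow_add] at h3
      rw [h3, hj', pow_add, two_mul, pow_add, pow_succ] at h2'
      linear_combination -h2'
    have hpe : (p : ℤ) ^ e ≠ 0 := by positivity
    have h5 : (p : ℤ) - (p : ℤ) ^ j * (p : ℤ) ^ j =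
        sign f * (-1) ^ (rank f * (p - 1) / 4) * (p : ℤ) ^ j * ((p : ℤ) - 1) := by
      refine mul_left_cancel₀ hpe ?_
      linear_combination h4
    have hp3 : (3 : ℤ) ≤ p := by exact_mod_cast hp2
    have hq1 : (1 : ℤ) ≤ (p : ℤ) ^ j := one_le_pow₀ (by omega)
    have hj0 : sign f = (-1) ^ (rank f * (p - 1) / 4) → j = 0 := by
      intro hs
      have hu : (-1 : ℤ) ^ (rank f * (p - 1) / 4) * (-1) ^ (rank f * (p - 1) / 4) = 1 := by
        rw [← mul_pow]
        simp
      rw [hs, hu] at h5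
      have h6 : ((p : ℤ) ^ j - 1) * ((p : ℤ) ^ j + p) = 0 := by linear_combination -h5
      have h7 : p ^ j = 1 := by
        rcases mul_eq_zero.1 h6 with h | h
        · exact_mod_cast sub_eq_zero.1 h
        · omega
      exact (Nat.pow_eq_one.1 h7).resolve_left (by omega)
    have hj1 : sign f ≠ (-1) ^ (rank f * (p - 1) / 4) → j = 1 := by
      intro hs
      have hε : sign f * (-1) ^ (rank f * (p - 1) / 4) = -1 := by
        rcases sign_eq_one_or hp f with h | h <;>
          rcases neg_one_pow_eq_or ℤ (rank f * (p - 1) / 4) with hu | hu <;> simp_all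
      rw [hε] at h5
      have h6 : ((p : ℤ) ^ j + 1) * ((p : ℤ) ^ j - p) = 0 := by linear_combination -h5
      have h7 : p ^ j = p ^ 1 := by
        rcases mul_eq_zero.1 h6 with h | h
        · omega
        · rw [pow_one]
          exact_mod_cast sub_eq_zero.1 h
      exact Nat.pow_right_injective (by omega) h7
    refine ⟨I, hI, ?_, fun h => hb ?_⟩
    · rw [e₀, if_neg hno]
      change e = if _ then n - _ else n - _
      rw [show rank f / 2 = m by omega, show (rank f + 2) / 2 = m + 1 by omega]
      clear h3 h2 h2' h4 h5 hpe hq1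
      split_ifs with hs
      · have := hj0 hs
        omega
      · have h6 := hj1 hs
        have h7 : n = e + (m + 1) := by omega
        exact (Nat.sub_eq_of_eq_add h7).symm
    · have := hj1 (h.resolve_left hno)
      omega
  · have ⟨m, hm⟩ := hodd
    have h3 := card_zero_of_odd_rank hp f hodd
    have h4 : p ^ e' = p ^ (e + 1) := by
      have : (p : ℤ) ^ e' = (p : ℤ) ^ (e + 1) := by linarith
      exact_mod_cast this
    have h5 := Nat.pow_right_injective (Fact.out : p.Prime).two_le h4
    refine ⟨I, hI, ?_, fun _ => hb (by omega)⟩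
    rw [e₀, if_pos hodd]
    change e = n - _
    omega

end Isotropic

/-! ### Double counting of hyperplane sections -/

section DoubleCounting

open scoped Classical

variable {p : ℕ} [Fact p.Prime] {V : Type*} [AddCommGroup V] [Module (ZMod p) V] [Fintype V]

/-- Double counting of the pairs `(h, y)` with `h ∈ H`, `y ∈ D` and `B h y = 0`. -/
theorem sum_card_hyperplane (D : Finset V) (B : V →ₗ[ZMod p] V →ₗ[ZMod p] ZMod p)
    (H : Submodule (ZMod p) V) :
    (p : ℤ) * ∑ h ∈ {h | h ∈ H}, (#{y ∈ D | B h y = 0} : ℤ) =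
      (p : ℤ) ^ Module.finrank (ZMod p) H *
        (((p : ℤ) - 1) * #{y ∈ D | ∀ h ∈ H, B h y = 0} + #D) := by
  have h1 : ∀ y ∈ D, (p : ℤ) * #{h | h ∈ H ∧ B h y = 0} =
      (p : ℤ) ^ Module.finrank (ZMod p) H *
        (((p : ℤ) - 1) * (if ∀ h ∈ H, B h y = 0 then 1 else 0) + 1) := by
    intro y _
    split_ifs with hy
    · have : #{h | h ∈ H ∧ B h y = 0} = #{h | h ∈ H} := by
        congr 1
        ext h
        simpa using hy h
      rw [this, card_submodule]
      push_cast
      ring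
    · push Not at hy
      have := card_filter_linear_eq H (B.flip y) hy 0
      rw [card_submodule] at this
      simp only [LinearMap.flip_apply] at this
      rw [mul_zero, zero_add, mul_one]
      exact_mod_cast this
  have h2 := Finset.sum_card_bipartiteAbove_eq_sum_card_bipartiteBelow
    (s := ({h | h ∈ H} : Finset V)) (t := D) (fun h y => B h y = 0)
  simp only [Finset.bipartiteAbove, Finset.bipartiteBelow, Finset.filter_filter] at h2
  rw [← Nat.cast_sum, h2, Nat.cast_sum, Finset.mul_sum, Finset.sum_congr rfl h1, ← Finset.mul_sum,
    Finset.sum_add_distrib, ← Finset.mul_sum]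
  simp

/-- Suppose that the hyperplane sections `h^⊥ ∩ D` have `N` points if `h ≠ 0` and `μ h = 0`. Then
the number of common zeros of `H` in `D` is determined by the excesses `#(h^⊥ ∩ D) - N` over the
`h ∈ H` with `μ h ≠ 0`. -/
theorem card_common_zeros (D : Finset V) (B : V →ₗ[ZMod p] V →ₗ[ZMod p] ZMod p)
    (μ : V →ₗ[ZMod p] ZMod p) {N : ℤ} (hD : (#D : ℤ) = p * N)
    (h0 : ∀ h, h ≠ 0 → μ h = 0 → (#{y ∈ D | B h y = 0} : ℤ) = N)
    (H : Submodule (ZMod p) V) {r : ℕ} (hr : Module.finrank (ZMod p) H = r + 1) :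
    (p : ℤ) ^ r * ((p : ℤ) - 1) * #{y ∈ D | ∀ h ∈ H, B h y = 0} = ((p : ℤ) - 1) * N +
      ∑ h ∈ {h | h ∈ H ∧ μ h ≠ 0}, ((#{y ∈ D | B h y = 0} : ℤ) - N) := by
  have hcount := sum_card_hyperplane D B H
  have hH : (#{h | h ∈ H} : ℤ) = (p : ℤ) ^ (r + 1) := by
    rw [card_submodule, hr]
    push_cast
    rfl
  have h1 : ∑ h ∈ {h | h ∈ H}, ((#{y ∈ D | B h y = 0} : ℤ) - N) = ((p : ℤ) - 1) * N +
      ∑ h ∈ {h | h ∈ H ∧ μ h ≠ 0}, ((#{y ∈ D | B h y = 0} : ℤ) - N) := by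
    rw [← Finset.sum_filter_add_sum_filter_not _ (fun h => μ h ≠ 0), Finset.filter_filter,
      Finset.filter_filter, add_comm]
    congr 1
    rw [Finset.sum_eq_single 0]
    · simp [hD]
      ring
    · intro h hh hne
      simp only [Finset.mem_filter, Finset.mem_univ, true_and, not_not] at hh
      rw [h0 h hne hh.2, sub_self]
    · simp
  rw [Finset.sum_sub_distrib, Finset.sum_const, nsmul_eq_mul, hH] at h1
  have hp0 : (p : ℤ) ≠ 0 := by exact_mod_cast (Fact.out : p.Prime).ne_zero
  rw [hD, hr] at hcount
  refine mul_left_cancel₀ hp0 ?_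
  rw [pow_succ] at hcount h1
  linear_combination (p : ℤ) * h1 - hcount

theorem card_filter_functional_ne_zero (μ : V →ₗ[ZMod p] ZMod p) (H : Submodule (ZMod p) V)
    {r : ℕ} (hr : Module.finrank (ZMod p) H = r + 1) (hμ : ∃ h ∈ H, μ h ≠ 0) :
    (#{h | h ∈ H ∧ μ h ≠ 0} : ℤ) = ((p : ℤ) - 1) * (p : ℤ) ^ r := by
  have h1 := card_filter_linear_eq H μ hμ 0
  have h2 := Finset.card_filter_add_card_filter_not (s := ({h | h ∈ H} : Finset V))
    (fun h => μ h = 0)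
  rw [Finset.filter_filter, Finset.filter_filter] at h2
  rw [card_submodule, hr, pow_succ'] at h1 h2
  have h3 := Nat.eq_of_mul_eq_mul_left (Fact.out : p.Prime).pos h1
  rw [h3] at h2
  have h4 : ((p ^ r : ℕ) : ℤ) + #{h | h ∈ H ∧ ¬ μ h = 0} = ((p * p ^ r : ℕ) : ℤ) := by
    exact_mod_cast h2
  push_cast at h4
  linear_combination h4

theorem card_common_zeros_le (D : Finset V) (B : V →ₗ[ZMod p] V →ₗ[ZMod p] ZMod p)
    (μ : V →ₗ[ZMod p] ZMod p) {N M : ℤ} (hD : (#D : ℤ) = p * N) (hM : 0 ≤ M)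
    (h0 : ∀ h, h ≠ 0 → μ h = 0 → (#{y ∈ D | B h y = 0} : ℤ) = N)
    (h1 : ∀ h, μ h ≠ 0 → (#{y ∈ D | B h y = 0} : ℤ) ≤ N + M)
    (H : Submodule (ZMod p) V) {r : ℕ} (hr : Module.finrank (ZMod p) H = r + 1) :
    (p : ℤ) ^ r * #{y ∈ D | ∀ h ∈ H, B h y = 0} ≤ N + (p : ℤ) ^ r * M := by
  have hp1 : (0 : ℤ) < (p : ℤ) - 1 := by
    have := (Fact.out : p.Prime).one_lt
    omega
  have h2 := card_common_zeros D B μ hD h0 H hr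
  have h3 : ∑ h ∈ {h | h ∈ H ∧ μ h ≠ 0}, ((#{y ∈ D | B h y = 0} : ℤ) - N) ≤
      (((p : ℤ) - 1) * (p : ℤ) ^ r) * M := by
    by_cases hμ : ∃ h ∈ H, μ h ≠ 0
    · rw [← card_filter_functional_ne_zero μ H hr hμ, ← nsmul_eq_mul]
      refine Finset.sum_le_card_nsmul _ _ _ fun h hh => ?_
      have := h1 h (Finset.mem_filter.1 hh).2.2
      linarith
    · push Not at hμ
      rw [Finset.sum_eq_zero]
      · positivity
      · intro h hh
        exact absurd (hμ h (Finset.mem_filter.1 hh).2.1) (Finset.mem_filter.1 hh).2.2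
  refine le_of_mul_le_mul_left ?_ hp1
  linear_combination h2 + h3

theorem exists_between_finrank {H L : Submodule (ZMod p) V} (hLH : L ≤ H) {k : ℕ}
    (hL : Module.finrank (ZMod p) L ≤ k) (hk : k ≤ Module.finrank (ZMod p) H) :
    ∃ H' : Submodule (ZMod p) V, L ≤ H' ∧ H' ≤ H ∧ Module.finrank (ZMod p) H' = k := by
  induction k, hL using Nat.le_induction with
  | base => exact ⟨L, le_rfl, hLH, rfl⟩
  | succ k _ ih =>
    obtain ⟨H', h1, h2, h3⟩ := ih (by omega)
    obtain ⟨x, hx, hx'⟩ : ∃ x ∈ H, x ∉ H' := by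
      by_contra! h
      have := Submodule.finrank_mono (show H ≤ H' from h)
      omega
    refine ⟨H' ⊔ Submodule.span (ZMod p) {x}, h1.trans le_sup_left, sup_le h2 ?_, ?_⟩
    · rwa [Submodule.span_singleton_le_iff_mem]
    · rw [Submodule.finrank_sup_span_singleton hx', h3]

/-- If the bound of `card_common_zeros_le` is attained in some dimension, then every `h` with
`μ h ≠ 0` has a hyperplane section of maximal size, and so the bound is attained by suitable
subspaces of all smaller positive dimensions. -/
theorem exists_card_common_zeros_eq (D : Finset V) (B : V →ₗ[ZMod p] V →ₗ[ZMod p] ZMod p)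
    (μ : V →ₗ[ZMod p] ZMod p) {N M : ℤ} (hD : (#D : ℤ) = p * N) (hM : 0 < M)
    (h0 : ∀ h, h ≠ 0 → μ h = 0 → (#{y ∈ D | B h y = 0} : ℤ) = N)
    (h1 : ∀ h, μ h ≠ 0 → (#{y ∈ D | B h y = 0} : ℤ) ≤ N + M)
    (H : Submodule (ZMod p) V) {r : ℕ} (hr : Module.finrank (ZMod p) H = r + 1)
    (hH : N + (p : ℤ) ^ r * M ≤ (p : ℤ) ^ r * #{y ∈ D | ∀ h ∈ H, B h y = 0})
    {k : ℕ} (hk : k ≤ r) :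
    ∃ H' : Submodule (ZMod p) V, Module.finrank (ZMod p) H' = k + 1 ∧
      (p : ℤ) ^ k * #{y ∈ D | ∀ h ∈ H', B h y = 0} = N + (p : ℤ) ^ k * M := by
  have hp1 : (0 : ℤ) < (p : ℤ) - 1 := by
    have := (Fact.out : p.Prime).one_lt
    omega
  have hpr : (0 : ℤ) < (p : ℤ) ^ r := by
    have := (Fact.out : p.Prime).pos
    positivity
  have h2 := card_common_zeros D B μ hD h0 H hr
  have h3 : (((p : ℤ) - 1) * (p : ℤ) ^ r) * M ≤
      ∑ h ∈ {h | h ∈ H ∧ μ h ≠ 0}, ((#{y ∈ D | B h y = 0} : ℤ) - N) := by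
    have := mul_le_mul_of_nonneg_left hH hp1.le
    linarith
  have hμ : ∃ h ∈ H, μ h ≠ 0 := by
    by_contra! hμ
    rw [Finset.filter_false_of_mem (fun h _ hh => hh.2 (hμ h hh.1)), Finset.sum_empty] at h3
    have : 0 < (((p : ℤ) - 1) * (p : ℤ) ^ r) * M := by positivity
    linarith
  have h4 : ∀ h ∈ H, μ h ≠ 0 → (#{y ∈ D | B h y = 0} : ℤ) - N = M := by
    have h5 : ∀ h ∈ ({h | h ∈ H ∧ μ h ≠ 0} : Finset V), (#{y ∈ D | B h y = 0} : ℤ) - N ≤ M := by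
      intro h hh
      have := h1 h (Finset.mem_filter.1 hh).2.2
      linarith
    rw [← card_filter_functional_ne_zero μ H hr hμ, ← nsmul_eq_mul, ← Finset.sum_const] at h3
    have h6 := (Finset.sum_eq_sum_iff_of_le h5).1 (le_antisymm (Finset.sum_le_sum h5) h3)
    intro h hh hne
    exact h6 h (by simp [hh, hne])
  obtain ⟨h, hh, hne⟩ := hμ
  obtain ⟨H', h5, h6, h7⟩ := exists_between_finrank (k := k + 1)
    ((Submodule.span_singleton_le_iff_mem h H).2 hh)
    (by rw [finrank_span_singleton (by rintro rfl; simp at hne)]; omega) (by omega)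
  have h8 : ∃ h ∈ H', μ h ≠ 0 := ⟨h, h5 (Submodule.mem_span_singleton_self h), hne⟩
  refine ⟨H', h7, ?_⟩
  have h9 := card_common_zeros D B μ hD h0 H' h7
  rw [Finset.sum_congr rfl (g := fun _ => M) (fun x hx => h4 x (h6 (Finset.mem_filter.1 hx).2.1)
    (Finset.mem_filter.1 hx).2.2), Finset.sum_const, nsmul_eq_mul,
    card_filter_functional_ne_zero μ H' h7 h8] at h9
  refine mul_left_cancel₀ hp1.ne' ?_
  linear_combination h9

end DoubleCounting

/-! ### Hyperplane sections of the zero set -/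

section Hyperplanes

open scoped Classical

variable {p : ℕ} [Fact p.Prime]
  {V₁ : Type*} [AddCommGroup V₁] [Module (ZMod p) V₁] [Fintype V₁]
  {V₂ : Type*} [AddCommGroup V₂] [Module (ZMod p) V₂] [Fintype V₂]

/-- Completing the square: if `ℓ` is not of the form `F(a, ·)`, it is nonzero on the radical, and
then `f = ℓ` has the average number of solutions; otherwise `f - ℓ` is a translate of `f - c`. -/
theorem card_eq_linear_le (hp : p ≠ 2) (f : QuadraticForm (ZMod p) V₁) {b : ℕ}
    (hb : ∀ c, #{x | f x = c} ≤ b) (hb' : p ^ Module.finrank (ZMod p) V₁ ≤ p * b)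
    (ℓ : V₁ →ₗ[ZMod p] ZMod p) : #{x | f x = ℓ x} ≤ b := by
  by_cases h : ∃ v ∈ LinearMap.ker (QuadraticMap.polarBilin f), ℓ v ≠ 0
  · obtain ⟨v, hv, hℓ⟩ := h
    have hpol : ∀ x, QuadraticMap.polar f v x = 0 := fun x => LinearMap.congr_fun hv x
    have hv0 : f v = 0 := by
      have h := hpol v
      rw [QuadraticMap.polar_self, two_smul, ← two_mul] at h
      exact (mul_eq_zero.1 h).resolve_left (two_ne_zero_zmod hp)
    have hfv : ∀ t : ZMod p, ∀ x, f (x + t • v) = f x + t ^ 2 * f v := by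
      intro t x
      rw [quadraticForm_add_smul, QuadraticMap.polar_comm, hpol]
      ring
    have h1 := card_filter_eq_of_affine (Submodule.span (ZMod p) {v})
      (fun _ => True) (fun x => f x - ℓ x) (fun _ => -ℓ) (by simp) ?_ ?_ 0
    · simp only [true_and, sub_eq_zero, Finset.filter_true, Finset.card_univ,
        card_space (p := p)] at h1
      rw [← h1] at hb'
      exact le_of_mul_le_mul_left hb' (Fact.out : p.Prime).pos
    · intro x _ u hu
      obtain ⟨t, rfl⟩ := Submodule.mem_span_singleton.1 hu
      rw [hfv, hv0]
      simp
      ring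
    · exact fun _ _ => ⟨v, Submodule.mem_span_singleton_self v, by simpa using hℓ⟩
  · push Not at h
    have h1 : ℓ ∈ LinearMap.range (QuadraticMap.polarBilin f).dualMap := by
      rw [LinearMap.range_dualMap_eq_dualAnnihilator_ker, Submodule.mem_dualAnnihilator]
      exact h
    obtain ⟨φ, rfl⟩ := h1
    obtain ⟨a, rfl⟩ := (Module.evalEquiv (ZMod p) V₁).surjective φ
    refine le_trans (le_of_eq ?_) (hb (f a))
    refine Finset.card_equiv (Equiv.addRight (-a)) fun x => ?_
    have h2 := quadraticForm_add_smul f x a (-1)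
    rw [neg_smul, one_smul] at h2
    simp only [Finset.mem_filter, Finset.mem_univ, true_and, Equiv.coe_addRight, h2]
    change f x = QuadraticMap.polar f x a ↔ _
    constructor
    · intro h
      rw [h]; ring
    · intro h
      linear_combination h

/-- The zeros of `f(x) + lam(y)`. -/
def zeroSet (f : QuadraticForm (ZMod p) V₁) (lam : V₂ →ₗ[ZMod p] ZMod p) : Finset (V₁ × V₂) :=
  {z | f z.1 + lam z.2 = 0}

theorem mem_zeroSet {f : QuadraticForm (ZMod p) V₁} {lam : V₂ →ₗ[ZMod p] ZMod p} {z : V₁ × V₂} :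
    z ∈ zeroSet f lam ↔ f z.1 + lam z.2 = 0 := by
  simp [zeroSet]

theorem card_filter_zeroSet (f : QuadraticForm (ZMod p) V₁) (lam : V₂ →ₗ[ZMod p] ZMod p)
    (S : V₁ × V₂ → Prop) [DecidablePred S]
    (hS : ∃ y, lam y ≠ 0 ∧ ∀ z, S z → ∀ t : ZMod p, S (z + (0, t • y))) :
    p * #{z ∈ zeroSet f lam | S z} = #{z | S z} := by
  obtain ⟨y, hy, hSy⟩ := hS
  have h := card_filter_eq_of_affine (Submodule.span (ZMod p) {((0 : V₁), y)}) S
    (fun z => f z.1 + lam z.2) (fun _ => lam ∘ₗ LinearMap.snd _ _ _) ?_ ?_ ?_ 0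
  · rw [zeroSet, Finset.filter_filter, ← h]
    congr 3
    ext z
    exact and_comm
  · intro z hz u hu
    obtain ⟨t, rfl⟩ := Submodule.mem_span_singleton.1 hu
    simpa using hSy z hz t
  · intro z hz u hu
    obtain ⟨t, rfl⟩ := Submodule.mem_span_singleton.1 hu
    simp
    ring
  · intro z hz
    exact ⟨(0, y), Submodule.mem_span_singleton_self _, hy⟩

theorem card_zeroSet (f : QuadraticForm (ZMod p) V₁) {lam : V₂ →ₗ[ZMod p] ZMod p}
    (hlam : ∃ y, lam y ≠ 0) : p * #(zeroSet f lam) =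
      p ^ (Module.finrank (ZMod p) V₁ + Module.finrank (ZMod p) V₂) := by
  obtain ⟨y, hy⟩ := hlam
  have h := card_filter_zeroSet f lam (fun _ => True) ⟨y, hy, fun _ _ _ => trivial⟩
  simpa [card_space (p := p), Module.finrank_prod, pow_add] using h

/-- The hyperplane sections of the zero set by `ψ₁(x) + ψ₂(y) = 0`, where `ψ₂` is not a nonzero
multiple of `lam`, have the average size. -/
theorem card_hyperplane_zeroSet (f : QuadraticForm (ZMod p) V₁) {lam : V₂ →ₗ[ZMod p] ZMod p}
    (ψ₁ : V₁ →ₗ[ZMod p] ZMod p) (ψ₂ : V₂ →ₗ[ZMod p] ZMod p)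
    (hψ : ∃ z : V₁ × V₂, ψ₁ z.1 + ψ₂ z.2 ≠ 0)
    (hy : ∃ y, lam y ≠ 0 ∧ ψ₂ y = 0) :
    p * (p * #{z ∈ zeroSet f lam | ψ₁ z.1 + ψ₂ z.2 = 0}) =
      p ^ (Module.finrank (ZMod p) V₁ + Module.finrank (ZMod p) V₂) := by
  obtain ⟨y, hy, hy'⟩ := hy
  rw [card_filter_zeroSet f lam (fun z => ψ₁ z.1 + ψ₂ z.2 = 0) ⟨y, hy, by
    intro z hz t
    simpa [hy'] using hz⟩]
  have h := card_filter_linear_eq ⊤ (LinearMap.coprod ψ₁ ψ₂) ⟨hψ.choose, trivial, hψ.choose_spec⟩ 0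
  simpa [card_space (p := p), Module.finrank_prod, pow_add] using h

/-- A hyperplane section by `ψ₁(x) + z lam(y) = 0` with `z ≠ 0` amounts to an equation
`f(x) = ℓ(x)` with `ℓ` linear. -/
theorem card_hyperplane_zeroSet_le (hp : p ≠ 2) (f : QuadraticForm (ZMod p) V₁)
    {lam : V₂ →ₗ[ZMod p] ZMod p} (hlam : ∃ y, lam y ≠ 0) {b : ℕ}
    (hb : ∀ c, #{x | f x = c} ≤ b) (hb' : p ^ Module.finrank (ZMod p) V₁ ≤ p * b)
    (ψ₁ : V₁ →ₗ[ZMod p] ZMod p) (ψ₂ : V₂ →ₗ[ZMod p] ZMod p) {t : ZMod p} (ht : t ≠ 0)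
    (hψ : ∀ y, ψ₂ y = t * lam y) :
    p * #{z ∈ zeroSet f lam | ψ₁ z.1 + ψ₂ z.2 = 0} ≤ b * p ^ Module.finrank (ZMod p) V₂ := by
  obtain ⟨y, hy⟩ := hlam
  have h1 : #{z ∈ zeroSet f lam | ψ₁ z.1 + ψ₂ z.2 = 0} =
      #{z ∈ zeroSet f lam | f z.1 = (t⁻¹ • ψ₁) z.1} := by
    rw [zeroSet, Finset.filter_filter, Finset.filter_filter]
    congr 1
    ext z
    simp only [Finset.mem_filter, Finset.mem_univ, true_and, hψ, LinearMap.smul_apply, smul_eq_mul]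
    refine and_congr_right fun h => ?_
    rw [eq_inv_mul_iff_mul_eq₀ ht]
    constructor
    · intro h'
      linear_combination t * h - h'
    · intro h'
      linear_combination t * h - h'
  rw [h1, card_filter_zeroSet f lam (fun z => f z.1 = (t⁻¹ • ψ₁) z.1) ⟨y, hy, by simp⟩]
  have h2 : ({z | f z.1 = (t⁻¹ • ψ₁) z.1} : Finset (V₁ × V₂)) =
      ({x | f x = (t⁻¹ • ψ₁) x} : Finset V₁) ×ˢ (univ : Finset V₂) := by
    ext z
    simp
  rw [h2, Finset.card_product, Finset.card_univ, card_space (p := p)]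
  exact Nat.mul_le_mul_right _ (card_eq_linear_le hp f hb hb' _)

omit [Fintype V₂] in
theorem exists_eq_smul_of_ker_le {ψ lam : V₂ →ₗ[ZMod p] ZMod p} {y₁ : V₂} (hy₁ : lam y₁ ≠ 0)
    (h : ∀ y, ψ y = 0 → lam y = 0) : ψ y₁ / lam y₁ ≠ 0 ∧ ∀ y, ψ y = ψ y₁ / lam y₁ * lam y := by
  have h0 : ψ y₁ ≠ 0 := fun h' => hy₁ (h y₁ h')
  refine ⟨div_ne_zero h0 hy₁, fun y => ?_⟩
  have h1 := h (y - (ψ y / ψ y₁) • y₁) (by simp [h0])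
  rw [map_sub, map_smul, smul_eq_mul, sub_eq_zero] at h1
  rw [h1]
  field_simp

end Hyperplanes

/-! ### Supports of subcodes -/

section TraceCode

open scoped Classical

variable {p : ℕ} [Fact p.Prime] {F₁ F₂ : Type*} [Field F₁] [Field F₂]
  [Algebra (ZMod p) F₁] [Algebra (ZMod p) F₂]

/-- The form `trProd` as a bilinear form. -/
def trForm (p : ℕ) [Fact p.Prime] (F₁ F₂ : Type*) [Field F₁] [Field F₂]
    [Algebra (ZMod p) F₁] [Algebra (ZMod p) F₂] : LinearMap.BilinForm (ZMod p) (F₁ × F₂) :=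
  LinearMap.mk₂ (ZMod p) trProd
    (fun X X' Y => by simp [trProd, add_mul]; ring)
    (fun c X Y => by simp [trProd, mul_add])
    (fun X Y Y' => by simp [trProd, mul_add]; ring)
    (fun c X Y => by simp [trProd, mul_add])

theorem trForm_apply (X Y : F₁ × F₂) : trForm p F₁ F₂ X Y =
    Algebra.traceForm (ZMod p) F₁ X.1 Y.1 + Algebra.traceForm (ZMod p) F₂ X.2 Y.2 := rfl

theorem trForm_isSymm : (trForm p F₁ F₂).IsSymm :=
  ⟨fun X Y => by simp [trForm_apply, Algebra.traceForm_apply, mul_comm]⟩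

/-- The evaluation map onto the code `C_D`. -/
def evalMap (f : QuadraticForm (ZMod p) F₁) (α : F₂) :
    (F₁ × F₂) →ₗ[ZMod p] (definingSet f α → ZMod p) where
  toFun X Y := trForm p F₁ F₂ X Y
  map_add' X X' := by ext; simp
  map_smul' c X := by ext; simp

theorem range_evalMap (f : QuadraticForm (ZMod p) F₁) (α : F₂) :
    LinearMap.range (evalMap f α) = code (ZMod p) (definingSet f α) := by
  ext c
  rfl

theorem finrank_map_evalMap {f : QuadraticForm (ZMod p) F₁} {α : F₂}
    (hinj : Function.Injective (evalMap f α)) (H : Submodule (ZMod p) (F₁ × F₂)) :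
    Module.finrank (ZMod p) (H.map (evalMap f α)) = Module.finrank (ZMod p) H :=
  (Submodule.equivMapOfInjective _ hinj H).finrank_eq.symm

variable [Fintype F₁] [Fintype F₂]

theorem trForm_nondegenerate : (trForm p F₁ F₂).Nondegenerate := by
  have hrefl : LinearMap.IsRefl (trForm p F₁ F₂) := trForm_isSymm.isRefl
  refine hrefl.nondegenerate_iff_separatingLeft.2 ?_
  intro X h
  refine Prod.ext ((traceForm_nondegenerate (ZMod p) F₁).1 _ fun y => ?_)
    ((traceForm_nondegenerate (ZMod p) F₂).1 _ fun y => ?_)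
  · simpa [trForm_apply] using h (y, 0)
  · simpa [trForm_apply] using h (0, y)

/-- The number of zeros of `f(x) + Tr(α y)` orthogonal to all of `H`. -/
def zeros (f : QuadraticForm (ZMod p) F₁) (α : F₂) (H : Submodule (ZMod p) (F₁ × F₂)) : ℕ :=
  #{y ∈ zeroSet f (Algebra.traceForm (ZMod p) F₂ α) | ∀ h ∈ H, trForm p F₁ F₂ h y = 0}

/-- The codeword positions outside the support of the subcode of `H`, and the excluded point `0`,
are the zeros orthogonal to `H`. -/
theorem ncard_supp_map (f : QuadraticForm (ZMod p) F₁) (α : F₂)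
    (H : Submodule (ZMod p) (F₁ × F₂)) :
    (supp (H.map (evalMap f α))).ncard + zeros f α H =
      #(zeroSet f (Algebra.traceForm (ZMod p) F₂ α)) := by
  have h1 : (supp (H.map (evalMap f α))).ncard =
      #{y ∈ zeroSet f (Algebra.traceForm (ZMod p) F₂ α) | ¬ ∀ h ∈ H, trForm p F₁ F₂ h y = 0} := by
    rw [← Set.ncard_image_of_injective _ Subtype.val_injective, ← Set.ncard_coe_finset]
    congr 1
    ext y
    simp only [supp, Set.mem_image, Set.mem_ofPred_eq, Finset.coe_filter, Submodule.mem_map]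
    constructor
    · rintro ⟨Y, ⟨_, ⟨X, hX, rfl⟩, hc⟩, rfl⟩
      refine ⟨?_, fun h => hc (h X hX)⟩
      simpa [mem_zeroSet, Algebra.traceForm_apply] using Y.2.2
    · rintro ⟨hy, h⟩
      push Not at h
      obtain ⟨X, hX, hne⟩ := h
      have hy0 : y ≠ (0, 0) := by
        rintro rfl
        exact hne (map_zero _)
      refine ⟨⟨y, hy0, ?_⟩, ⟨_, ⟨X, hX, rfl⟩, hne⟩, rfl⟩
      simpa [mem_zeroSet, Algebra.traceForm_apply] using hy
  rw [h1, zeros, add_comm, Finset.card_filter_add_card_filter_not]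

/-- A generalized Hamming weight is found by maximizing `zeros f α H`. -/
theorem ghw_code_eq {f : QuadraticForm (ZMod p) F₁} {α : F₂}
    (hinj : Function.Injective (evalMap f α)) {r z : ℕ}
    (hle : ∀ H : Submodule (ZMod p) (F₁ × F₂), Module.finrank (ZMod p) H = r → zeros f α H ≤ z)
    {H₀ : Submodule (ZMod p) (F₁ × F₂)} (hH₀ : Module.finrank (ZMod p) H₀ = r)
    (hz : zeros f α H₀ = z) :
    ghw (code (ZMod p) (definingSet f α)) r + z =
      #(zeroSet f (Algebra.traceForm (ZMod p) F₂ α)) := by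
  have h0 := ncard_supp_map f α H₀
  rw [hz] at h0
  rw [← h0]
  congr 1
  refine IsLeast.csInf_eq ⟨⟨H₀.map (evalMap f α), ?_, ?_, rfl⟩, ?_⟩
  · rw [← range_evalMap]
    exact LinearMap.map_le_range
  · rw [finrank_map_evalMap hinj, hH₀]
  · rintro m ⟨H, hH, hr, rfl⟩
    rw [← range_evalMap] at hH
    obtain ⟨H', rfl⟩ : ∃ H', H'.map (evalMap f α) = H :=
      ⟨H.comap (evalMap f α), Submodule.map_comap_eq_of_le hH⟩
    rw [finrank_map_evalMap hinj] at hr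
    have h1 := ncard_supp_map f α H'
    have h2 := hle H' hr
    omega

theorem finrank_orthogonal_trForm (W : Submodule (ZMod p) (F₁ × F₂)) :
    Module.finrank (ZMod p) ((trForm p F₁ F₂).orthogonal W) + Module.finrank (ZMod p) W =
      Module.finrank (ZMod p) F₁ + Module.finrank (ZMod p) F₂ := by
  rw [LinearMap.BilinForm.finrank_orthogonal trForm_nondegenerate, ← Module.finrank_prod]
  have := Submodule.finrank_le W
  omega

theorem zeros_le (f : QuadraticForm (ZMod p) F₁) (α : F₂) (H : Submodule (ZMod p) (F₁ × F₂)) :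
    zeros f α H ≤ p ^ (Module.finrank (ZMod p) F₁ + Module.finrank (ZMod p) F₂ -
      Module.finrank (ZMod p) H) := by
  rw [← finrank_orthogonal_trForm H, Nat.add_sub_cancel, ← card_submodule]
  refine Finset.card_le_card fun y hy => ?_
  simpa using (Finset.mem_filter.1 hy).2

theorem zeros_orthogonal (f : QuadraticForm (ZMod p) F₁) (α : F₂)
    (W : Submodule (ZMod p) (F₁ × F₂)) :
    zeros f α ((trForm p F₁ F₂).orthogonal W) =
      #{y ∈ zeroSet f (Algebra.traceForm (ZMod p) F₂ α) | y ∈ W} := by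
  rw [zeros]
  congr 1
  ext y
  simp only [Finset.mem_filter]
  refine and_congr_right fun _ => ?_
  conv_rhs => rw [← LinearMap.BilinForm.orthogonal_orthogonal trForm_nondegenerate
    trForm_isSymm.isRefl W]
  rfl

end TraceCode

/-! ### Weights from sections of the zero set -/

section Hierarchy

open scoped Classical

variable {p : ℕ} [Fact p.Prime] {F₁ F₂ : Type*} [Field F₁] [Field F₂]
  [Algebra (ZMod p) F₁] [Algebra (ZMod p) F₂] [Fintype F₁] [Fintype F₂]

theorem exists_traceForm_ne_zero {α : F₂} (hα : α ≠ 0) :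
    ∃ y, Algebra.traceForm (ZMod p) F₂ α y ≠ 0 := by
  by_contra! h
  exact hα ((traceForm_nondegenerate (ZMod p) F₂).1 α h)

/-- Sizes of the sections of the zero set of `f(x) + Tr(α y)` by the hyperplanes `h^⊥`, given a
bound for the fibres of `f`. The functional `μ` vanishes at `h` only if `h.2` is not a nonzero
multiple of `α`. -/
theorem exists_functional_hyperplane_sections (hp : p ≠ 2) (f : QuadraticForm (ZMod p) F₁) {α : F₂}
    (hα : α ≠ 0) {n k b₁ : ℕ} (hn : Module.finrank (ZMod p) F₁ = n + 1)
    (hk : Module.finrank (ZMod p) F₂ = k + 1) (hb : ∀ c, #{x | f x = c} ≤ p ^ n + b₁) :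
    ∃ μ : (F₁ × F₂) →ₗ[ZMod p] ZMod p,
      (∀ h, h ≠ 0 → μ h = 0 →
        #{y ∈ zeroSet f (Algebra.traceForm (ZMod p) F₂ α) | trForm p F₁ F₂ h y = 0} =
          p ^ (n + k)) ∧
      (∀ h, μ h ≠ 0 →
        #{y ∈ zeroSet f (Algebra.traceForm (ZMod p) F₂ α) | trForm p F₁ F₂ h y = 0} ≤
          p ^ (n + k) + p ^ k * b₁) := by
  have hppos : 0 < p := (Fact.out : p.Prime).pos
  obtain ⟨y₁, hy₁⟩ := exists_traceForm_ne_zero (p := p) hα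
  set lam := Algebra.traceForm (ZMod p) F₂ α with hlam
  have hA : ∀ h : F₁ × F₂, h ≠ 0 → (∃ y, lam y ≠ 0 ∧ Algebra.traceForm (ZMod p) F₂ h.2 y = 0) →
      #{y ∈ zeroSet f lam | trForm p F₁ F₂ h y = 0} = p ^ (n + k) := by
    intro h hne hy
    have hψ : ∃ z : F₁ × F₂, Algebra.traceForm (ZMod p) F₁ h.1 z.1 +
        Algebra.traceForm (ZMod p) F₂ h.2 z.2 ≠ 0 := by
      by_contra! h'
      exact hne (trForm_nondegenerate.1 h h')
    have h1 := card_hyperplane_zeroSet f _ _ hψ hy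
    rw [hn, hk, show n + 1 + (k + 1) = (n + k) + 1 + 1 by ring, pow_succ', pow_succ'] at h1
    exact Nat.eq_of_mul_eq_mul_left hppos (Nat.eq_of_mul_eq_mul_left hppos h1)
  refine ⟨((Algebra.traceForm (ZMod p) F₂).flip y₁) ∘ₗ LinearMap.snd _ _ _, ?_, ?_⟩
  · intro h hne hμ
    exact hA h hne ⟨y₁, hy₁, hμ⟩
  · intro h hμ
    by_cases hy : ∃ y, lam y ≠ 0 ∧ Algebra.traceForm (ZMod p) F₂ h.2 y = 0
    · -- the average value is below the bound
      rw [hA h (by rintro rfl; simp at hμ) hy]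
      exact Nat.le_add_right _ _
    · push Not at hy
      obtain ⟨ht, hψ⟩ := exists_eq_smul_of_ker_le (ψ := Algebra.traceForm (ZMod p) F₂ h.2) hy₁
        (fun y hy0 => by
          by_contra hne
          exact hy y hne hy0)
      have hb' : p ^ Module.finrank (ZMod p) F₁ ≤ p * (p ^ n + b₁) := by
        rw [hn, pow_succ']
        exact Nat.mul_le_mul_left _ (Nat.le_add_right _ _)
      have h1 := card_hyperplane_zeroSet_le hp f ⟨y₁, hy₁⟩ hb hb'
        (Algebra.traceForm (ZMod p) F₁ h.1) _ ht hψ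
      refine le_of_mul_le_mul_left (h1.trans (le_of_eq ?_)) hppos
      rw [hk]
      ring

/-- If the fibres of `f` exceed their average size `p ^ n` by at most `b₁`, and if some subspace
`W` contains many zeros of `f(x) + Tr(α y)`, then the first generalized Hamming weights are
determined by `b₁`, up to the codimension of `W`. -/
theorem ghw_code_of_large_section (hp : p ≠ 2) (f : QuadraticForm (ZMod p) F₁) {α : F₂}
    (hα : α ≠ 0) {n k b₁ m : ℕ} (hn : Module.finrank (ZMod p) F₁ = n + 1)
    (hk : Module.finrank (ZMod p) F₂ = k + 1) (hb : ∀ c, #{x | f x = c} ≤ p ^ n + b₁)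
    (hb0 : 0 < b₁) (W : Submodule (ZMod p) (F₁ × F₂))
    (hW : Module.finrank (ZMod p) W + (m + 1) = n + k + 2) (hm : m ≤ n + k)
    (hWc : p ^ (n + k) + p ^ (m + k) * b₁ ≤
      p ^ m * #{y ∈ zeroSet f (Algebra.traceForm (ZMod p) F₂ α) | y ∈ W})
    (hinj : Function.Injective (evalMap f α)) {r : ℕ} (hr : r ≤ m) :
    (ghw (code (ZMod p) (definingSet f α)) (r + 1) : ℤ) =
      (p : ℤ) ^ (n + k + 1) - (p : ℤ) ^ (n + k - r) - (p : ℤ) ^ k * b₁ := by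
  have hppos : 0 < p := (Fact.out : p.Prime).pos
  obtain ⟨μ, h0, h1⟩ := exists_functional_hyperplane_sections hp f hα hn hk hb
  have hD : #(zeroSet f (Algebra.traceForm (ZMod p) F₂ α)) = p * p ^ (n + k) := by
    have h := card_zeroSet f (exists_traceForm_ne_zero (p := p) hα)
    rw [hn, hk, show n + 1 + (k + 1) = (n + k) + 1 + 1 by ring, pow_succ', pow_succ'] at h
    exact Nat.eq_of_mul_eq_mul_left hppos h
  have hDz : (#(zeroSet f (Algebra.traceForm (ZMod p) F₂ α)) : ℤ) = p * (p : ℤ) ^ (n + k) := by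
    exact_mod_cast hD
  have h0z : ∀ h, h ≠ 0 → μ h = 0 →
      (#{y ∈ zeroSet f (Algebra.traceForm (ZMod p) F₂ α) | trForm p F₁ F₂ h y = 0} : ℤ) =
        (p : ℤ) ^ (n + k) := fun h hh hμ => by exact_mod_cast h0 h hh hμ
  have h1z : ∀ h, μ h ≠ 0 →
      (#{y ∈ zeroSet f (Algebra.traceForm (ZMod p) F₂ α) | trForm p F₁ F₂ h y = 0} : ℤ) ≤
        (p : ℤ) ^ (n + k) + (p : ℤ) ^ k * b₁ := fun h hμ => by exact_mod_cast h1 h hμ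
  have hMpos : (0 : ℤ) < (p : ℤ) ^ k * b₁ := by positivity
  have hperp : Module.finrank (ZMod p) ((trForm p F₁ F₂).orthogonal W) = m + 1 := by
    have := finrank_orthogonal_trForm (p := p) W
    omega
  obtain ⟨H, hH, hHc⟩ := exists_card_common_zeros_eq _ (trForm p F₁ F₂) μ hDz hMpos h0z h1z
    ((trForm p F₁ F₂).orthogonal W) hperp (by
      change _ ≤ _ * (zeros f α _ : ℤ)
      rw [zeros_orthogonal, ← mul_assoc, ← pow_add]
      exact_mod_cast hWc) hr
  change (p : ℤ) ^ r * (zeros f α H : ℤ) = _ at hHc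
  have hpr : (p : ℤ) ^ r ≠ 0 := by positivity
  have hsplit : (p : ℤ) ^ (n + k) = (p : ℤ) ^ r * (p : ℤ) ^ (n + k - r) := by
    rw [← pow_add]
    congr 1
    omega
  have hz : zeros f α H = p ^ (n + k - r) + p ^ k * b₁ := by
    have : (zeros f α H : ℤ) = (p : ℤ) ^ (n + k - r) + (p : ℤ) ^ k * b₁ := by
      refine mul_left_cancel₀ hpr ?_
      rw [hHc, hsplit]
      ring
    exact_mod_cast this
  have hfinal := ghw_code_eq hinj (r := r + 1) (z := p ^ (n + k - r) + p ^ k * b₁) ?_ hH hz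
  · rw [hD] at hfinal
    have : (ghw (code (ZMod p) (definingSet f α)) (r + 1) : ℤ) +
        ((p : ℤ) ^ (n + k - r) + (p : ℤ) ^ k * b₁) = p * (p : ℤ) ^ (n + k) := by
      exact_mod_cast hfinal
    rw [pow_succ']
    linarith
  · intro H' hH'
    have h3 := card_common_zeros_le _ (trForm p F₁ F₂) μ hDz hMpos.le h0z h1z H' hH'
    change (p : ℤ) ^ r * (zeros f α H' : ℤ) ≤ _ at h3
    rw [hsplit, ← mul_add] at h3
    have := le_of_mul_le_mul_left h3 (by positivity)
    exact_mod_cast this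

/-- A nonzero `X` in the kernel would give a hyperplane `X^⊥` containing all zeros of
`f(x) + Tr(α y)`, more than hyperplane sections can have. -/
theorem evalMap_injective (hp : p ≠ 2) (f : QuadraticForm (ZMod p) F₁) {α : F₂}
    (hα : α ≠ 0) {n k b₁ : ℕ} (hn : Module.finrank (ZMod p) F₁ = n + 1)
    (hk : Module.finrank (ZMod p) F₂ = k + 1) (hb : ∀ c, #{x | f x = c} ≤ p ^ n + b₁)
    (hb1 : b₁ ≤ p ^ n) : Function.Injective (evalMap f α) := by
  have hppos : 0 < p := (Fact.out : p.Prime).pos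
  have hp3 : 2 < p := lt_of_le_of_ne (Fact.out : p.Prime).two_le hp.symm
  obtain ⟨μ, h0, h1⟩ := exists_functional_hyperplane_sections hp f hα hn hk hb
  have hD : #(zeroSet f (Algebra.traceForm (ZMod p) F₂ α)) = p * p ^ (n + k) := by
    have h := card_zeroSet f (exists_traceForm_ne_zero (p := p) hα)
    rw [hn, hk, show n + 1 + (k + 1) = (n + k) + 1 + 1 by ring, pow_succ', pow_succ'] at h
    exact Nat.eq_of_mul_eq_mul_left hppos h
  rw [← LinearMap.ker_eq_bot, LinearMap.ker_eq_bot']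
  intro X hX
  by_contra hne
  have h2 : #{y ∈ zeroSet f (Algebra.traceForm (ZMod p) F₂ α) | trForm p F₁ F₂ X y = 0} =
      p * p ^ (n + k) := by
    rw [← hD]
    congr 1
    refine Finset.filter_true_of_mem fun y hy => ?_
    by_cases hy0 : y = (0, 0)
    · rw [hy0]
      exact map_zero _
    · exact congrFun hX ⟨y, hy0, mem_zeroSet.1 hy⟩
  have h3 : p ^ k * b₁ ≤ p ^ (n + k) := by
    rw [add_comm, pow_add]
    exact Nat.mul_le_mul_left _ hb1
  have h4 : 3 * p ^ (n + k) ≤ p * p ^ (n + k) := Nat.mul_le_mul_right _ hp3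
  have h5 : 0 < p ^ (n + k) := by positivity
  by_cases hμ : μ X = 0
  · have := h0 X hne hμ
    omega
  · have := h1 X hμ
    omega

/-- A subspace of dimension `s - r` consisting of zeros of `f(x) + Tr(α y)` gives the weight
`p ^ (s - 1) - p ^ (s - r)`. -/
theorem ghw_code_of_isotropic (f : QuadraticForm (ZMod p) F₁) {α : F₂}
    (hα : α ≠ 0) {s : ℕ} (hs : Module.finrank (ZMod p) F₁ + Module.finrank (ZMod p) F₂ = s)
    (hinj : Function.Injective (evalMap f α)) (W : Submodule (ZMod p) (F₁ × F₂))
    (hW : ∀ y ∈ W, y ∈ zeroSet f (Algebra.traceForm (ZMod p) F₂ α)) {r : ℕ} (hrs : r ≤ s)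
    (hr : s - r ≤ Module.finrank (ZMod p) W) (hspos : 0 < s) :
    (ghw (code (ZMod p) (definingSet f α)) r : ℤ) = (p : ℤ) ^ (s - 1) - (p : ℤ) ^ (s - r) := by
  have hppos : 0 < p := (Fact.out : p.Prime).pos
  obtain ⟨W', -, hW', hd⟩ := exists_between_finrank (bot_le : ⊥ ≤ W) (k := s - r) (by simp) hr
  have hperp := finrank_orthogonal_trForm (p := p) W'
  have h1 := ghw_code_eq hinj (r := r) (z := p ^ (s - r)) ?_
    (H₀ := (trForm p F₁ F₂).orthogonal W') (by omega) ?_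
  · have h := card_zeroSet f (exists_traceForm_ne_zero (p := p) hα)
    rw [hs, ← h1] at h
    have h2 : ghw (code (ZMod p) (definingSet f α)) r + p ^ (s - r) = p ^ (s - 1) := by
      refine Nat.eq_of_mul_eq_mul_left hppos ?_
      rw [h, ← pow_succ']
      congr 1
      omega
    rw [eq_sub_iff_add_eq]
    exact_mod_cast h2
  · intro H hH
    have := zeros_le f α H
    rwa [hs, hH] at this
  · rw [zeros_orthogonal, ← hd, ← card_submodule]
    congr 1
    ext y
    simpa using fun h => hW y (hW' h)

theorem finrank_prod_ker {lam : F₂ →ₗ[ZMod p] ZMod p} (hlam : ∃ y, lam y ≠ 0)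
    (I : Submodule (ZMod p) F₁) : Module.finrank (ZMod p) (I.prod (LinearMap.ker lam)) + 1 =
      Module.finrank (ZMod p) I + Module.finrank (ZMod p) F₂ := by
  have h1 : Module.finrank (ZMod p) (I.prod (LinearMap.ker lam)) =
      Module.finrank (ZMod p) I + Module.finrank (ZMod p) (LinearMap.ker lam) := by
    rw [← Module.finrank_prod]
    have h := LinearMap.finrank_range_of_inj
      (f := I.subtype.prodMap (LinearMap.ker lam).subtype)
      (Function.Injective.prodMap I.injective_subtype (LinearMap.ker lam).injective_subtype)
    rwa [LinearMap.range_prodMap, Submodule.range_subtype, Submodule.range_subtype] at h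
  have h2 := LinearMap.finrank_range_add_finrank_ker lam
  have h3 : LinearMap.range lam = ⊤ := by
    rw [LinearMap.range_eq_top]
    exact LinearMap.surjective (fun h => by simp [h] at hlam)
  rw [h3, finrank_top, Module.finrank_self] at h2
  omega

/-- If `b ∉ I` is orthogonal to the totally isotropic subspace `I`, adjoining a zero `(b, y₀)` of
`f(x) + lam(y)` to `W = I × ker lam` yields a subspace with at least `2 |W|` zeros: those in `W`
and in `W + (b, y₀)`. -/
theorem exists_subspace_two_cosets (f : QuadraticForm (ZMod p) F₁) {lam : F₂ →ₗ[ZMod p] ZMod p}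
    (hlam : ∃ y, lam y ≠ 0) {I : Submodule (ZMod p) F₁} (hI : ∀ x ∈ I, f x = 0) {b : F₁}
    (hb : b ∉ I) (hbI : ∀ i ∈ I, QuadraticMap.polar f i b = 0) :
    ∃ W : Submodule (ZMod p) (F₁ × F₂),
      Module.finrank (ZMod p) W = Module.finrank (ZMod p) (I.prod (LinearMap.ker lam)) + 1 ∧
      2 * p ^ Module.finrank (ZMod p) (I.prod (LinearMap.ker lam)) ≤
        #{y ∈ zeroSet f lam | y ∈ W} := by
  obtain ⟨y₀, hy₀⟩ := LinearMap.surjective (fun h => by simp [h] at hlam : lam ≠ 0) (-f b)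
  set W₀ := I.prod (LinearMap.ker lam) with hW₀
  have hv : ((b, y₀) : F₁ × F₂) ∉ W₀ := fun h => hb h.1
  refine ⟨W₀ ⊔ Submodule.span (ZMod p) {(b, y₀)}, Submodule.finrank_sup_span_singleton hv, ?_⟩
  have hcard : #((univ.filter (· ∈ W₀)).map (addRightEmbedding ((b, y₀) : F₁ × F₂))) =
      #{y | y ∈ W₀} := Finset.card_map _
  have hdisj : Disjoint (univ.filter (· ∈ W₀))
      ((univ.filter (· ∈ W₀)).map (addRightEmbedding ((b, y₀) : F₁ × F₂))) := by
    rw [Finset.disjoint_left]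
    intro z hz hz'
    obtain ⟨w, hw, rfl⟩ := Finset.mem_map.1 hz'
    simp only [Finset.mem_filter, Finset.mem_univ, true_and, addRightEmbedding_apply] at hz hw
    exact hv ((Submodule.add_mem_iff_right _ hw).1 hz)
  have h2 : 2 * p ^ Module.finrank (ZMod p) W₀ = #((univ.filter (· ∈ W₀)) ∪
      ((univ.filter (· ∈ W₀)).map (addRightEmbedding ((b, y₀) : F₁ × F₂)))) := by
    rw [Finset.card_union_of_disjoint hdisj, hcard, card_submodule, two_mul]
  rw [h2]
  refine Finset.card_le_card fun z hz => ?_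
  rw [Finset.mem_filter, mem_zeroSet]
  rcases Finset.mem_union.1 hz with hz | hz
  · have hz : z ∈ W₀ := by simpa using hz
    refine ⟨?_, Submodule.mem_sup_left hz⟩
    rw [hI _ hz.1, LinearMap.mem_ker.1 hz.2, add_zero]
  · obtain ⟨w, hw, rfl⟩ := Finset.mem_map.1 hz
    have hw : w ∈ W₀ := by simpa using hw
    refine ⟨?_, Submodule.add_mem_sup hw (Submodule.mem_span_singleton_self _)⟩
    have h3 := quadraticForm_add_smul f w.1 b 1
    rw [one_smul, hI _ hw.1, hbI _ hw.1] at h3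
    simp only [addRightEmbedding_apply, Prod.fst_add, Prod.snd_add, map_add, h3,
      LinearMap.mem_ker.1 hw.2, hy₀]
    ring

end Hierarchy

/-! ### The extremal sections and the weight hierarchy -/

section Extremal

open scoped Classical

variable {p : ℕ} [Fact p.Prime] {F₁ F₂ : Type*} [Field F₁] [Field F₂]
  [Algebra (ZMod p) F₁] [Algebra (ZMod p) F₂] [Fintype F₁] [Fintype F₂]

/-- The largest excess `b₁` of a fibre of `f` over the average `p ^ n`, together with a subspace
`W` of codimension `m + 1` attaining the bound that it implies. In the hyperbolic case `W` is
`I × ker lam` with `I` maximal totally isotropic; in the other cases it is one dimension larger. -/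
theorem exists_excess_and_section (hp : p ≠ 2) (f : QuadraticForm (ZMod p) F₁)
    (hR : 3 ≤ rank f) {lam : F₂ →ₗ[ZMod p] ZMod p} (hlam : ∃ y, lam y ≠ 0) {n k : ℕ}
    (hn : Module.finrank (ZMod p) F₁ = n + 1) (hk : Module.finrank (ZMod p) F₂ = k + 1) :
    ∃ (m b₁ : ℕ) (W : Submodule (ZMod p) (F₁ × F₂)),
      1 ≤ m ∧ m ≤ n ∧ n + 1 - e₀ f ≤ m + 1 ∧ (∀ c, #{x | f x = c} ≤ p ^ n + b₁) ∧
      0 < b₁ ∧ b₁ ≤ p ^ n ∧ Module.finrank (ZMod p) W + (m + 1) = n + k + 2 ∧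
      p ^ (n + k) + p ^ (m + k) * b₁ ≤ p ^ m * #{y ∈ zeroSet f lam | y ∈ W} ∧
      ((b₁ = p ^ (n - m) ∧ (rank f = 2 * m + 1 ∨
          rank f = 2 * m ∧ sign f ≠ (-1) ^ (rank f * (p - 1) / 4))) ∨
        (b₁ = (p - 1) * p ^ (n - m) ∧ rank f = 2 * m ∧
          sign f = (-1) ^ (rank f * (p - 1) / 4))) := by
  have hp1 : 1 < p := (Fact.out : p.Prime).one_lt
  have hppos : 0 < p := by omega
  have hRn := finrank_ker_polarBilin (two_ne_zero_zmod hp) f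
  rw [hn] at hRn
  obtain ⟨I, hI, hIe, hb⟩ := exists_isotropic hp f
  have hW₀ := finrank_prod_ker hlam I
  by_cases hyp : Even (rank f) ∧ sign f = (-1) ^ (rank f * (p - 1) / 4)
  · obtain ⟨hev, hs⟩ := hyp
    obtain ⟨m, hm⟩ := hev.two_dvd
    have he : e₀ f = n + 1 - m := by
      rw [e₀, if_neg (Nat.not_odd_iff_even.2 hev), if_pos hs, hn, hm,
        Nat.mul_div_cancel_left _ two_pos]
    have hsplit : p ^ (n + 1 - m) = p ^ (n - m) + (p - 1) * p ^ (n - m) := by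
      rw [show n + 1 - m = n - m + 1 by omega, pow_succ', Nat.sub_mul, one_mul,
        Nat.add_sub_cancel' (Nat.le_mul_of_pos_left _ hppos)]
    refine ⟨m, (p - 1) * p ^ (n - m), I.prod (LinearMap.ker lam), by omega, by omega, by omega,
      fun c => ?_, Nat.mul_pos (by omega) (by positivity), ?_, by omega, ?_, Or.inr ⟨rfl, hm, hs⟩⟩
    · have h1 := card_eq_of_even_rank hp f hm c
      have h2 : (-1 : ℤ) ^ (rank f * (p - 1) / 4) * (-1) ^ (rank f * (p - 1) / 4) = 1 := by
        rw [← mul_pow]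
        simp
      rw [hs, h2, one_mul, hn] at h1
      have h3 : (p : ℤ) * #{x | f x = c} ≤
          (p : ℤ) ^ (n + 1) + (p : ℤ) ^ (n + 1 - m) * ((p : ℤ) - 1) := by
        rw [h1, add_le_add_iff_left]
        refine mul_le_mul_of_nonneg_left ?_ (by positivity)
        split_ifs <;> omega
      have h4 : (((p - 1 : ℕ)) : ℤ) = (p : ℤ) - 1 := by
        rw [Nat.cast_sub hp1.le, Nat.cast_one]
      rw [← h4, show n + 1 - m = n - m + 1 by omega] at h3
      have h5 : p * #{x | f x = c} ≤ p ^ (n + 1) + p ^ (n - m + 1) * (p - 1) := by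
        exact_mod_cast h3
      refine le_of_mul_le_mul_left (h5.trans (le_of_eq ?_)) hppos
      ring
    · calc (p - 1) * p ^ (n - m) ≤ p ^ (n + 1 - m) := by omega
        _ ≤ p ^ n := Nat.pow_le_pow_right hppos (by omega)
    · have h1 : #{y ∈ zeroSet f lam | y ∈ I.prod (LinearMap.ker lam)} =
          p ^ (n + 1 - m + k) := by
        rw [show n + 1 - m + k = Module.finrank (ZMod p) (I.prod (LinearMap.ker lam)) by omega,
          ← card_submodule]
        congr 1
        ext y
        simp only [Finset.mem_filter, Finset.mem_univ, true_and, and_iff_right_iff_imp, mem_zeroSet]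
        intro hy
        rw [hI _ hy.1, LinearMap.mem_ker.1 hy.2, add_zero]
      rw [h1, pow_add p (n + 1 - m), hsplit]
      have h2 : p ^ (n + k) = p ^ m * (p ^ (n - m) * p ^ k) := by
        rw [← pow_add, ← pow_add]
        congr 1
        omega
      rw [h2, pow_add]
      exact le_of_eq (by ring)
  · have hyp' : Odd (rank f) ∨ sign f ≠ (-1) ^ (rank f * (p - 1) / 4) := by
      rcases Nat.even_or_odd (rank f) with h | h
      · exact Or.inr fun hs => hyp ⟨h, hs⟩
      · exact Or.inl h
    obtain ⟨b, hbI, hbo⟩ := hb hyp'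
    obtain ⟨W, hWd, hWc⟩ := exists_subspace_two_cosets f hlam hI hbI hbo
    obtain ⟨m, hm⟩ : ∃ m, rank f = 2 * m ∨ rank f = 2 * m + 1 := ⟨rank f / 2, by omega⟩
    have he : e₀ f = n - m := by
      rcases hm with hm | hm
      · have hno : ¬ Odd (rank f) := Nat.not_odd_iff_even.2 ⟨m, by omega⟩
        rw [e₀, if_neg hno, if_neg (hyp'.resolve_left hno), hn, hm]
        omega
      · rw [e₀, if_pos ⟨m, hm⟩, hn, hm]
        omega
    have hfib : ∀ c, (p : ℤ) * #{x | f x = c} ≤ (p : ℤ) ^ (n + 1) + (p : ℤ) ^ (n + 1 - m) := by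
      intro c
      rcases hm with hm | hm
      · have hno : ¬ Odd (rank f) := Nat.not_odd_iff_even.2 ⟨m, by omega⟩
        have hs : sign f * (-1) ^ (rank f * (p - 1) / 4) = -1 := by
          have hne := hyp'.resolve_left hno
          rcases sign_eq_one_or hp f with h | h <;>
            rcases neg_one_pow_eq_or ℤ (rank f * (p - 1) / 4) with hu | hu <;> simp_all
        rw [card_eq_of_even_rank hp f hm c, hs, hn, add_le_add_iff_left, neg_one_mul, neg_mul,
          ← mul_neg]
        refine mul_le_of_le_one_right (by positivity) ?_
        split_ifs <;> omega
      · have := card_le_of_odd_rank hp f hm c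
        rwa [hn] at this
    have hmn : m < n := by omega
    refine ⟨m, p ^ (n - m), W, by omega, by omega, by omega, fun c => ?_, by positivity,
      Nat.pow_le_pow_right hppos (by omega), by omega, ?_, Or.inl ⟨rfl, ?_⟩⟩
    · have h1 := hfib c
      rw [show n + 1 - m = n - m + 1 by omega] at h1
      have h2 : p * #{x | f x = c} ≤ p ^ (n + 1) + p ^ (n - m + 1) := by exact_mod_cast h1
      refine le_of_mul_le_mul_left (h2.trans (le_of_eq ?_)) hppos
      ring
    · refine le_trans (le_of_eq ?_) (Nat.mul_le_mul_left _ hWc)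
      rw [show Module.finrank (ZMod p) (I.prod (LinearMap.ker lam)) = n - m + k by omega]
      have h2 : p ^ (n + k) = p ^ m * (p ^ (n - m) * p ^ k) := by
        rw [← pow_add, ← pow_add]
        congr 1
        omega
      rw [h2, pow_add, pow_add]
      ring
    · rcases hm with hm | hm
      · exact Or.inr ⟨hm, hyp'.resolve_left (Nat.not_odd_iff_even.2 ⟨m, by omega⟩)⟩
      · exact Or.inl hm

end Extremal

end WeightHierarchy

end

open WeightHierarchy in
theorem theorem1 (p : ℕ) [Fact p.Prime] (hp : p ≠ 2)
    (s₁ s₂ s : ℕ) (hs : s = s₁ + s₂)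
    (F₁ F₂ : Type*) [Field F₁] [Field F₂] [Finite F₁] [Finite F₂]
    [Algebra (ZMod p) F₁] [Algebra (ZMod p) F₂]
    (hs₁ : Module.finrank (ZMod p) F₁ = s₁) (hs₂ : Module.finrank (ZMod p) F₂ = s₂)
    (f : QuadraticForm (ZMod p) F₁) (hf : 3 ≤ rank f) (α : F₂) (hα : α ≠ 0) :
    Module.finrank (ZMod p) (code (ZMod p) (definingSet f α)) = s ∧
    (∀ r : ℕ, s₁ - e₀ f + 1 ≤ r → r ≤ s →
      (ghw (code (ZMod p) (definingSet f α)) r : ℤ) = (p : ℤ) ^ (s - 1) - (p : ℤ) ^ (s - r)) ∧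
    (∀ r : ℕ, 0 < r → r ≤ s₁ - e₀ f →
      (Odd (rank f) →
        (ghw (code (ZMod p) (definingSet f α)) r : ℤ) =
          (p : ℤ) ^ (s - 1) - (p : ℤ) ^ (s - 1 - r)
            - (p : ℤ) ^ (s - 1 - (rank f + 1) / 2)) ∧
      (Even (rank f) → sign f = (-1) ^ (rank f * (p - 1) / 4) →
        (ghw (code (ZMod p) (definingSet f α)) r : ℤ) =
          (p : ℤ) ^ (s - 1) - (p : ℤ) ^ (s - 1 - r)
            - ((p : ℤ) - 1) * (p : ℤ) ^ (s - 1 - (rank f + 2) / 2)) ∧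
      (Even (rank f) → sign f = -(-1) ^ (rank f * (p - 1) / 4) →
        (ghw (code (ZMod p) (definingSet f α)) r : ℤ) =
          (p : ℤ) ^ (s - 1) - (p : ℤ) ^ (s - 1 - r)
            - (p : ℤ) ^ (s - 1 - (rank f + 2) / 2))) := by
  classical
  have := Fintype.ofFinite F₁
  have := Fintype.ofFinite F₂
  have hp1 : 1 < p := (Fact.out : p.Prime).one_lt
  obtain ⟨n, rfl⟩ : ∃ n, s₁ = n + 1 :=
    ⟨s₁ - 1, by have := Module.finrank_pos (R := ZMod p) (M := F₁); omega⟩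
  obtain ⟨k, rfl⟩ : ∃ k, s₂ = k + 1 :=
    ⟨s₂ - 1, by have := Module.finrank_pos (R := ZMod p) (M := F₂); omega⟩
  have hlam := exists_traceForm_ne_zero (p := p) hα
  obtain ⟨m, b₁, W, hm1, hmn, he, hb, hb0, hb1, hW, hWc, hcase⟩ :=
    exists_excess_and_section hp f hf hlam hs₁ hs₂
  have hinj := evalMap_injective hp f hα hs₁ hs₂ hb hb1
  have hsmall : ∀ r, 0 < r → r ≤ n + 1 - e₀ f →
      (ghw (code (ZMod p) (definingSet f α)) r : ℤ) =
        (p : ℤ) ^ (s - 1) - (p : ℤ) ^ (s - 1 - r) - (p : ℤ) ^ k * b₁ := by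
    intro r hr0 hr
    obtain ⟨r, rfl⟩ : ∃ r', r = r' + 1 := ⟨r - 1, by omega⟩
    rw [ghw_code_of_large_section hp f hα hs₁ hs₂ hb hb0 W hW (by omega) hWc hinj (by omega),
      show n + k + 1 = s - 1 by omega, show n + k - r = s - 1 - (r + 1) by omega]
  -- in all three cases the last exponent of the claim is `s - 2 - m`
  have hpow : ∀ j, j = m + 1 → (p : ℤ) ^ (s - 1 - j) = (p : ℤ) ^ k * (p : ℤ) ^ (n - m) := by
    intro j hj
    rw [← pow_add]
    congr 1
    omega
  refine ⟨?_, ?_, ?_⟩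
  · rw [← range_evalMap, LinearMap.finrank_range_of_inj hinj, Module.finrank_prod, hs₁, hs₂, hs]
  · -- `f(x) + Tr(α y)` vanishes on `I × ker lam` for `I` totally isotropic
    intro r hr hrs
    obtain ⟨I, hI, hIe, -⟩ := exists_isotropic hp f
    have hd := finrank_prod_ker hlam I
    refine ghw_code_of_isotropic f hα (by omega) hinj
      (I.prod (LinearMap.ker (Algebra.traceForm (ZMod p) F₂ α))) (fun y hy => ?_) hrs (by omega)
      (by omega)
    rw [mem_zeroSet, hI _ hy.1, LinearMap.mem_ker.1 hy.2, add_zero]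
  · intro r hr0 hr
    rw [hsmall r hr0 hr]
    refine ⟨fun hodd => ?_, fun hev hsg => ?_, fun hev hsg => ?_⟩
    · rcases hcase with ⟨rfl, h | h⟩ | ⟨rfl, h, -⟩
      · rw [hpow ((rank f + 1) / 2) (by omega)]
        push_cast
        rfl
      · exact absurd hodd (Nat.not_odd_iff_even.2 ⟨m, by omega⟩)
      · exact absurd hodd (Nat.not_odd_iff_even.2 ⟨m, by omega⟩)
    · rcases hcase with ⟨rfl, h | h⟩ | ⟨rfl, h, -⟩
      · exact absurd hev (Nat.not_even_iff_odd.2 ⟨m, h⟩)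
      · exact absurd hsg h.2
      · rw [hpow ((rank f + 2) / 2) (by omega)]
        push_cast [Nat.cast_sub hp1.le]
        ring
    · rcases hcase with ⟨rfl, h | h⟩ | ⟨rfl, h, h'⟩
      · exact absurd hev (Nat.not_even_iff_odd.2 ⟨m, h⟩)
      · rw [hpow ((rank f + 2) / 2) (by omega)]
        push_cast
        rfl
      · rw [h'] at hsg
        have := pow_ne_zero (rank f * (p - 1) / 4) (by norm_num : (-1 : ℤ) ≠ 0)
        exact absurd (self_eq_neg.1 hsg) this
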